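/- Let $G$ be a (finite-dimensional, real) Lie group with Lie algebra $\mathfrak g=T_eG$, let $L:TG\to\mathbb R$ be a smooth ($C^\infty$) Lagrangian, and let $a<b$. Write the left action of $G$ on $TG$ and $T^*G$ by concatenation, so that $g\xi=T_eL_g\,\xi\in T_gG$ and $g^{-1}v=T_gL_{g^{-1}}v\in\mathfrak g$ for $\xi\in\mathfrak g$, $v\in T_gG$, and $\langle g^{-1}p,\xi\rangle=\langle p,g\xi\rangle$ for $p\in T_g^*G$. Let $\ell:G\times\mathfrak g\to\mathbb R$, $\ell(g,\xi)=L(g,g\xi)$, be the left-trivialization of $L$. All curves are $C^\infty$ on $[a,b]$, and a variation of a curve $c$ is a family $(c_\varepsilon)_{|\varepsilon|<\delta}$ of curves, $C^\infty$ in $(\varepsilon,t)\in(-\delta,\delta)\times[a,b]$, with $c_0=c$; $\delta\int=0$ means that $\frac{d}{d\varepsilon}\big|_{\varepsilon=0}\int=0$ for all variations of the stated kind. For every smooth curve $g:[a,b]\to G$ the following are equivalent. 1. (Hamilton's principle) $\delta\int_a^bL(g,\dot g)\,dt=0$ for all variations of $g$ with $g(a)$ and $g(b)$ fixed. 2. (Reduced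 variational principle) With $\xi=g^{-1}\dot g$, $\delta\int_a^b\ell(g,\xi)\,dt=0$ for all variations of $(g,\xi)$ in $G\times\mathfrak g$ such that $\eta=g^{-1}\delta g$ satisfies $\eta(a)=\eta(b)=0$ and $\delta\xi=\dot\eta+\operatorname{ad}_\xi\eta$, where $\delta g=\frac{\partial}{\partial\varepsilon}\big|_{\varepsilon=0}g_\varepsilon$ and $\delta\xi=\frac{\partial}{\partial\varepsilon}\big|_{\varepsilon=0}\xi_\varepsilon$. 3. (Hamilton-Pontryagin principle) There are $v$ and $p$ such that $(g,v,p)$ is a smooth curve in $TG\oplus T^*G$ and $\delta\int_a^b\left[L(g,v)+\langle p,\dot g-v\rangle\right]dt=0$ for all variations of $(g,v,p)$ in $TG\oplus T^*G$ with $g(a)$ and $g(b)$ fixed. 4. (Left-trivialized Hamilton-Pontryagin principle) There are smooth curves $\xi$ in $\mathfrak g$ and $\mu$ in $\mathfrak g^*$ such that $\delta\int_a^b\left[\ell(g,\xi)+\langle\mu,g^{-1}\dot g-\xi\rangle\right]dt=0$ for all variations of $(g,\xi,\mu)$ in $G\times\mathfrak g\times\mathfrak g^*$ with $g(a)$ and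 $g(b)$ fixed. Moreover, a smooth curve $(g,v,p)$ in $TG\oplus T^*G$ satisfies the principle in (3) if and only if $(g,g^{-1}v,g^{-1}p)$ satisfies the principle in (4); and if $(g,v,p)$ satisfies the principle in (3), then $v=\dot g$ and $p=\frac{\partial L}{\partial v}(g,v)$ on $[a,b]$. -/

import Mathlib

open Set Bundle
open scoped Manifold ContDiff

noncomputable section

namespace HamiltonPontryagin

section Defs

variable {E : Type*} [NormedAddCommGroup E] [NormedSpace ℝ E]
  {H : Type*} [TopologicalSpace H] (I : ModelWithCorners ℝ E H)
  {G : Type*} [TopologicalSpace G] [ChartedSpace H G]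

/-- The velocity `ġ(t) ∈ T_{g(t)}G` of a curve `g : [a, b] → G` (one-sided at the endpoints). -/
def velocity (a b : ℝ) (g : ℝ → G) (t : ℝ) : TangentSpace I (g t) :=
  mfderivWithin 𝓘(ℝ, ℝ) I g (Icc a b) t (1 : ℝ)

/-- The parameter domain `(-δ, δ) × [a, b]` of a one-parameter family of curves. -/
def strip (δ a b : ℝ) : Set (ℝ × ℝ) := Ioo (-δ) δ ×ˢ Icc a b

/-- `C^∞` regularity of a one-parameter family of curves `g ε : [a, b] → G`, `ε ∈ (-δ, δ)`,
jointly in the parameter and the time. -/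
def SmoothFamily (δ a b : ℝ) (g : ℝ → ℝ → G) : Prop :=
  ContMDiffOn 𝓘(ℝ, ℝ × ℝ) I ∞ (fun x : ℝ × ℝ => g x.1 x.2) (strip δ a b)

variable (G) in
/-- The Pontryagin bundle `TG ⊕ T*G` (Whitney sum over `G`). A point is `⟨g, (v, p)⟩` with
`v ∈ T_gG` and `p ∈ T*_gG`. -/
abbrev PontryaginBundle : Type _ :=
  TotalSpace (E × (E →L[ℝ] ℝ))
    ((TangentSpace I : G → Type _) ×ᵇ fun x : G => TangentSpace I x →L[ℝ] ℝ)

/-- The action `∫ₐᵇ L(g, ġ) dt`. -/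
def action (L : TangentBundle I G → ℝ) (a b : ℝ) (g : ℝ → G) : ℝ :=
  ∫ t in a..b, L ⟨g t, velocity I a b g t⟩

/-- Hamilton's principle for the curve `g : [a, b] → G`: the action is stationary along every
smooth variation of `g` with fixed endpoints. -/
def HamiltonPrinciple (L : TangentBundle I G → ℝ) (a b : ℝ) (g : ℝ → G) : Prop :=
  ∀ (δ : ℝ) (γ : ℝ → ℝ → G), 0 < δ → SmoothFamily I δ a b γ →
    (∀ t ∈ Icc a b, γ 0 t = g t) →
    (∀ ε ∈ Ioo (-δ) δ, γ ε a = g a ∧ γ ε b = g b) →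
    HasDerivAt (fun ε => action I L a b (γ ε)) 0 0

/-- The Hamilton-Pontryagin action `∫ₐᵇ [L(g, v) + ⟨p, ġ - v⟩] dt` of a curve
`c = (g, v, p)` in `TG ⊕ T*G`. -/
def hpAction (L : TangentBundle I G → ℝ) (a b : ℝ) (c : ℝ → PontryaginBundle I G) : ℝ :=
  ∫ t in a..b, (L ⟨(c t).proj, (c t).2.1⟩ +
    (c t).2.2 (velocity I a b (fun s => (c s).proj) t - (c t).2.1))

section PontryaginPaths

variable [IsManifold I 1 G]

/-- `C^∞` curves `[a, b] → TG ⊕ T*G`. -/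
def SmoothPontryaginPath (a b : ℝ) (c : ℝ → PontryaginBundle I G) : Prop :=
  ContMDiffOn 𝓘(ℝ, ℝ) (I.prod 𝓘(ℝ, E × (E →L[ℝ] ℝ))) ∞ c (Icc a b)

/-- The Hamilton-Pontryagin principle for the curve `c = (g, v, p) : [a, b] → TG ⊕ T*G`: the
Hamilton-Pontryagin action is stationary along every smooth variation of `c` in `TG ⊕ T*G`
that fixes the endpoints `g(a)`, `g(b)` of the base curve, but not `v` and `p`. -/
def HPPrinciple (L : TangentBundle I G → ℝ) (a b : ℝ) (c : ℝ → PontryaginBundle I G) : Prop :=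
  ∀ (δ : ℝ) (γ : ℝ → ℝ → PontryaginBundle I G), 0 < δ →
    ContMDiffOn 𝓘(ℝ, ℝ × ℝ) (I.prod 𝓘(ℝ, E × (E →L[ℝ] ℝ))) ∞
      (fun x : ℝ × ℝ => γ x.1 x.2) (strip δ a b) →
    (∀ t ∈ Icc a b, γ 0 t = c t) →
    (∀ ε ∈ Ioo (-δ) δ, (γ ε a).proj = (c a).proj ∧ (γ ε b).proj = (c b).proj) →
    HasDerivAt (fun ε => hpAction I L a b (γ ε)) 0 0

end PontryaginPaths

variable [Group G]

/-- The left action `v ↦ g⁻¹ v` of `g⁻¹` on `v ∈ T_gG`, with values in the Lie algebra. -/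
def toLieAlgebra (g : G) (v : TangentSpace I g) : GroupLieAlgebra I G :=
  mfderiv I I (fun x : G => g⁻¹ * x) g v

/-- The left action `p ↦ g⁻¹ p` of `g⁻¹` on `p ∈ T*_gG`, with values in the dual of the Lie
algebra: `⟨g⁻¹ p, ξ⟩ = ⟨p, g ξ⟩`. -/
def toDualLieAlgebra (g : G) (p : TangentSpace I g →L[ℝ] ℝ) : GroupLieAlgebra I G →L[ℝ] ℝ :=
  ContinuousLinearMap.comp (M₂ := E) p (mfderiv I I (fun x : G => g * x) (1 : G))

/-- The left trivialization `(g, v, p) ↦ (g, g⁻¹ v, g⁻¹ p)` from `TG ⊕ T*G` to `G × 𝔤 × 𝔤*`. -/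
def leftTrivialization (x : PontryaginBundle I G) :
    G × GroupLieAlgebra I G × (GroupLieAlgebra I G →L[ℝ] ℝ) :=
  (x.proj, toLieAlgebra I x.proj x.2.1, toDualLieAlgebra I x.proj x.2.2)

/-- The left-trivialized Lagrangian `ℓ(g, ξ) = L(g, g ξ)`; the left translate `g ξ` is
`mulInvariantVectorField ξ g`. -/
def trivializedLagrangian (L : TangentBundle I G → ℝ) (g : G) (ξ : GroupLieAlgebra I G) : ℝ :=
  L ⟨g, mulInvariantVectorField ξ g⟩

/-- The reduced velocity `g⁻¹ ġ` of a curve `g : [a, b] → G`. -/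
def reducedVelocity (a b : ℝ) (g : ℝ → G) (t : ℝ) : GroupLieAlgebra I G :=
  toLieAlgebra I (g t) (velocity I a b g t)

/-- The left-trivialized infinitesimal variation `η = g⁻¹ δg` of a family of curves, where `δg`
is the derivative with respect to the parameter at `0`. -/
def infinitesimalVariation (γ : ℝ → ℝ → G) (t : ℝ) : GroupLieAlgebra I G :=
  toLieAlgebra I (γ 0 t) (mfderiv 𝓘(ℝ, ℝ) I (fun ε => γ ε t) 0 (1 : ℝ))

/-- The time derivative of a curve `η : [a, b] → 𝔤`; as a vector space, `𝔤 = T_1G` is the model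
space `E`. -/
def lieDerivWithin (a b : ℝ) (η : ℝ → GroupLieAlgebra I G) (t : ℝ) : GroupLieAlgebra I G :=
  derivWithin (F := E) η (Icc a b) t

/-- The reduced variational principle for the curve `g : [a, b] → G` with `ξ = g⁻¹ ġ`:
`∫ₐᵇ ℓ(g, ξ) dt` is stationary along every smooth variation `(γ ε, ζ ε)` of `(g, ξ)` in `G × 𝔤`
whose infinitesimal variation has the form `δg = g η`, `δξ = η̇ + ad_ξ η` with
`η(a) = η(b) = 0`. -/
def ReducedPrinciple (l : G → GroupLieAlgebra I G → ℝ) (a b : ℝ) (g : ℝ → G) : Prop :=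
  ∀ (δ : ℝ) (γ : ℝ → ℝ → G) (ζ : ℝ → ℝ → GroupLieAlgebra I G) (η : ℝ → GroupLieAlgebra I G),
    0 < δ → SmoothFamily I δ a b γ →
    ContDiffOn ℝ ∞ (F := E) (fun x : ℝ × ℝ => ζ x.1 x.2) (strip δ a b) →
    (∀ t ∈ Icc a b, γ 0 t = g t ∧ ζ 0 t = reducedVelocity I a b g t) →
    (∀ t ∈ Icc a b, η t = infinitesimalVariation I γ t) →
    (∀ t ∈ Icc a b, HasDerivAt (F := E) (fun ε => ζ ε t)
      (lieDerivWithin I a b η t + ⁅reducedVelocity I a b g t, η t⁆) 0) →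
    η a = 0 → η b = 0 →
    HasDerivAt (fun ε => ∫ t in a..b, l (γ ε t) (ζ ε t)) 0 0

/-- The left-trivialized Hamilton-Pontryagin action `∫ₐᵇ [ℓ(g, ξ) + ⟨μ, g⁻¹ ġ - ξ⟩] dt` of a curve
`c = (g, ξ, μ)` in `G × 𝔤 × 𝔤*`. -/
def trivializedHPAction (l : G → GroupLieAlgebra I G → ℝ) (a b : ℝ)
    (c : ℝ → G × GroupLieAlgebra I G × (GroupLieAlgebra I G →L[ℝ] ℝ)) : ℝ :=
  ∫ t in a..b, (l (c t).1 (c t).2.1 +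
    (c t).2.2 (reducedVelocity I a b (fun s => (c s).1) t - (c t).2.1))

/-- `C^∞` curves `[a, b] → G × 𝔤 × 𝔤*`. -/
def SmoothTrivializedPath (a b : ℝ)
    (c : ℝ → G × GroupLieAlgebra I G × (GroupLieAlgebra I G →L[ℝ] ℝ)) : Prop :=
  ContMDiffOn 𝓘(ℝ, ℝ) I ∞ (fun t => (c t).1) (Icc a b) ∧
    ContDiffOn ℝ ∞ (F := E) (fun t => (c t).2.1) (Icc a b) ∧
    ContDiffOn ℝ ∞ (F := E →L[ℝ] ℝ) (fun t => (c t).2.2) (Icc a b)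

/-- The left-trivialized Hamilton-Pontryagin principle for the curve
`c = (g, ξ, μ) : [a, b] → G × 𝔤 × 𝔤*`: the left-trivialized action is stationary along every smooth
variation of `c` in `G × 𝔤 × 𝔤*` that fixes `g(a)` and `g(b)`. -/
def TrivializedHPPrinciple (l : G → GroupLieAlgebra I G → ℝ) (a b : ℝ)
    (c : ℝ → G × GroupLieAlgebra I G × (GroupLieAlgebra I G →L[ℝ] ℝ)) : Prop :=
  ∀ (δ : ℝ) (γ : ℝ → ℝ → G × GroupLieAlgebra I G × (GroupLieAlgebra I G →L[ℝ] ℝ)), 0 < δ →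
    SmoothFamily I δ a b (fun ε t => (γ ε t).1) →
    ContDiffOn ℝ ∞ (F := E) (fun x : ℝ × ℝ => (γ x.1 x.2).2.1) (strip δ a b) →
    ContDiffOn ℝ ∞ (F := E →L[ℝ] ℝ) (fun x : ℝ × ℝ => (γ x.1 x.2).2.2) (strip δ a b) →
    (∀ t ∈ Icc a b, γ 0 t = c t) →
    (∀ ε ∈ Ioo (-δ) δ, (γ ε a).1 = (c a).1 ∧ (γ ε b).1 = (c b).1) →
    HasDerivAt (fun ε => trivializedHPAction I l a b (γ ε)) 0 0

end Defs

end HamiltonPontryagin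

end

/-! Left translation is a smooth isomorphism `TG ≅ G × E` (`maurerCartan`, `leftTranslateBundle`),
so every action can be written with `l(g, ξ) = L(g, g ξ)`. The pairing is invariant under it, so the
Hamilton-Pontryagin action equals its trivialized form (`hpAction_eq`) and the principles 3 and 4
are the same statement.

The one geometric input is the Maurer-Cartan equation (`maurerCartan_equation`). On a two-parameter
family it says that `ξ = g⁻¹ ġ` and `η = g⁻¹ δg` satisfy `δξ = η̇ + [ξ, η]`
(`hasDerivAt_reducedVelocity`). The rest uses that a first variation depends only on the
infinitesimal data of the family (`hasDerivAt_integral_lagrangian`,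
`hasDerivAt_trivializedHPAction`).

Each `η` vanishing at the endpoints is realised by a variation with fixed endpoints, so Hamilton's
principle yields the weak equation `∫ dl(η, η̇ + [ξ, η]) = 0`
(`HamiltonPrinciple.integral_eq_zero`). This is the first variation in 2. It is also the one in 4
once `ξ = g⁻¹ ġ` and `μ = ∂l/∂ξ`, because then the terms in `δξ` and `δμ` cancel. Conversely,
Hamilton's variations are special cases of those in 2. In 4, varying `ξ` and `μ` alone forces `ξ =
g⁻¹ ġ` and `μ = ∂l/∂ξ`; along families with `ξ = g⁻¹ ġ` the constraint term vanishes and the action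
of 1 is left. No integration by parts and no Euler-Lagrange equation is needed. -/

noncomputable section

namespace HamiltonPontryagin

/-! ### Calculus on the strip `(-δ, δ) × [a, b]` -/

section StripCalculus

variable {F : Type*} [NormedAddCommGroup F] [NormedSpace ℝ F] {δ a b : ℝ}

lemma uniqueDiffOn_strip (hab : a < b) : UniqueDiffOn ℝ (strip δ a b) :=
  isOpen_Ioo.uniqueDiffOn.prod (uniqueDiffOn_Icc hab)

lemma mem_strip_zero (hδ : 0 < δ) {t : ℝ} (ht : t ∈ Icc a b) : ((0 : ℝ), t) ∈ strip δ a b :=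
  ⟨⟨neg_lt_zero.2 hδ, hδ⟩, ht⟩

/-- The strip contains the edges `t = a` and `t = b`. Second derivatives within it are symmetric
there because edge points are limits of interior points. -/
lemma strip_subset_closure_interior (hab : a < b) :
    strip δ a b ⊆ closure (interior (strip δ a b)) := by
  rw [strip, interior_prod_eq, interior_Icc, isOpen_Ioo.interior_eq, closure_prod_eq,
    closure_Ioo hab.ne]
  exact prod_mono_left subset_closure

/-- The parameter interval is open, so the derivative in `ε` is two-sided even at `t = a` and `t =
b`. -/
lemma hasDerivAt_param_of_differentiableWithinAt {h : ℝ × ℝ → F} {x : ℝ × ℝ}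
    (hh : DifferentiableWithinAt ℝ h (strip δ a b) x) (hx : x ∈ strip δ a b) :
    HasDerivAt (fun ε => h (ε, x.2)) (fderivWithin ℝ h (strip δ a b) x (1, 0)) x.1 := by
  have h1 : HasDerivWithinAt (fun ε : ℝ => (ε, x.2)) ((1 : ℝ), (0 : ℝ)) (Ioo (-δ) δ) x.1 :=
    (hasDerivWithinAt_id _ _).prodMk (hasDerivWithinAt_const _ _ _)
  have h2 := hh.hasFDerivWithinAt.comp_hasDerivWithinAt (f := fun ε : ℝ => (ε, x.2)) x.1 h1
    (fun ε hε => ⟨hε, hx.2⟩)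
  exact h2.hasDerivAt (isOpen_Ioo.mem_nhds hx.1)

lemma hasDerivWithinAt_time_of_differentiableWithinAt {h : ℝ × ℝ → F} {x : ℝ × ℝ}
    (hh : DifferentiableWithinAt ℝ h (strip δ a b) x) (hx : x ∈ strip δ a b) :
    HasDerivWithinAt (fun t => h (x.1, t)) (fderivWithin ℝ h (strip δ a b) x (0, 1))
      (Icc a b) x.2 := by
  have h1 : HasDerivWithinAt (fun t : ℝ => (x.1, t)) ((0 : ℝ), (1 : ℝ)) (Icc a b) x.2 :=
    (hasDerivWithinAt_const _ _ _).prodMk (hasDerivWithinAt_id _ _)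
  exact hh.hasFDerivWithinAt.comp_hasDerivWithinAt (f := fun t : ℝ => (x.1, t)) x.2 h1
    (fun t ht => ⟨hx.1, ht⟩)

lemma contDiffOn_fderivWithin_strip_apply (hab : a < b) {h : ℝ × ℝ → F}
    (hh : ContDiffOn ℝ ∞ h (strip δ a b)) (w : ℝ × ℝ) :
    ContDiffOn ℝ ∞ (fun x => fderivWithin ℝ h (strip δ a b) x w) (strip δ a b) :=
  (hh.fderivWithin (uniqueDiffOn_strip hab) (by simp)).clm_apply contDiffOn_const

/-- The time slice at parameter `0` of a smooth function on the strip is smooth. -/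
lemma contDiffOn_slice (hδ : 0 < δ) {h : ℝ × ℝ → F} (hh : ContDiffOn ℝ ∞ h (strip δ a b)) :
    ContDiffOn ℝ ∞ (fun t => h (0, t)) (Icc a b) :=
  hh.comp (contDiff_const.prodMk contDiff_id).contDiffOn fun _ ht => mem_strip_zero hδ ht

lemma contDiffOn_deriv_param (hab : a < b) (hδ : 0 < δ) {h : ℝ × ℝ → F}
    (hh : ContDiffOn ℝ ∞ h (strip δ a b)) :
    ContDiffOn ℝ ∞ (fun t => deriv (fun ε => h (ε, t)) 0) (Icc a b) := by
  refine (contDiffOn_slice hδ (contDiffOn_fderivWithin_strip_apply hab hh (1, 0))).congr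
    fun t ht => ?_
  have hx := mem_strip_zero hδ ht
  exact (hasDerivAt_param_of_differentiableWithinAt
    (hh.differentiableOn (by simp) _ hx) hx).deriv

/-- Differentiation under the integral sign for a smooth function on the strip. -/
lemma hasDerivAt_integral_strip (hab : a < b) (hδ : 0 < δ) {h : ℝ → ℝ → ℝ} {h' : ℝ → ℝ}
    (hh : ContDiffOn ℝ ∞ (fun x : ℝ × ℝ => h x.1 x.2) (strip δ a b))
    (hd : ∀ t ∈ Icc a b, HasDerivAt (fun ε => h ε t) (h' t) 0) :
    HasDerivAt (fun ε => ∫ t in a..b, h ε t) (∫ t in a..b, h' t) 0 := by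
  set k : ℝ × ℝ → ℝ := fun x => h x.1 x.2 with hk
  set D : ℝ × ℝ → ℝ := fun x => fderivWithin ℝ k (strip δ a b) x (1, 0) with hD
  have hDc : ContinuousOn D (strip δ a b) :=
    (contDiffOn_fderivWithin_strip_apply hab hh (1, 0)).continuousOn
  have hder : ∀ x ∈ strip δ a b, HasDerivAt (fun ε => h ε x.2) (D x) x.1 := fun x hx =>
    hasDerivAt_param_of_differentiableWithinAt (hh.differentiableOn (by simp) _ hx) hx
  -- Halving `δ` gives a compact rectangle, on which the continuous `D` has a constant bound that
  -- serves as dominating function.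
  have hsub : Icc (-(δ / 2)) (δ / 2) ×ˢ Icc a b ⊆ strip δ a b :=
    prod_mono_left fun ε hε => ⟨by linarith [hε.1], by linarith [hε.2]⟩
  obtain ⟨C, hC⟩ := (isCompact_Icc.prod isCompact_Icc).exists_bound_of_continuousOn
    (hDc.mono hsub)
  have hIoc : Set.uIoc a b ⊆ Icc a b := by
    rw [uIoc_of_le hab.le]; exact Ioc_subset_Icc_self
  have hcont : ∀ ε ∈ Ioo (-δ) δ, ContinuousOn (fun t => h ε t) (Icc a b) := fun ε hε =>
    hh.continuousOn.comp (continuous_const.prodMk continuous_id).continuousOn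
      fun t ht => ⟨hε, ht⟩
  have hDcont : ContinuousOn (fun t => D (0, t)) (Icc a b) :=
    hDc.comp (continuous_const.prodMk continuous_id).continuousOn
      fun t ht => mem_strip_zero hδ ht
  have hint : ∀ ε ∈ Ioo (-δ) δ, IntervalIntegrable (fun t => h ε t) MeasureTheory.volume a b :=
    fun ε hε => ContinuousOn.intervalIntegrable (by rw [uIcc_of_le hab.le]; exact hcont ε hε)
  have hDint : IntervalIntegrable (fun t => D (0, t)) MeasureTheory.volume a b :=
    ContinuousOn.intervalIntegrable (by rw [uIcc_of_le hab.le]; exact hDcont)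
  have h0 : (0 : ℝ) ∈ Ioo (-δ) δ := ⟨neg_lt_zero.2 hδ, hδ⟩
  have key := intervalIntegral.hasDerivAt_integral_of_dominated_loc_of_deriv_le
    (μ := MeasureTheory.volume) (F := h) (F' := fun ε t => D (ε, t)) (x₀ := (0 : ℝ))
    (s := Ioo (-(δ / 2)) (δ / 2)) (bound := fun _ => C) (a := a) (b := b)
    (Ioo_mem_nhds (by linarith) (by linarith))
    (by
      filter_upwards [Ioo_mem_nhds h0.1 h0.2] with ε hε
      exact (hint ε hε).def'.aestronglyMeasurable)
    (hint 0 h0) hDint.def'.aestronglyMeasurable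
    (Filter.Eventually.of_forall fun t ht ε hε =>
      hC (ε, t) ⟨Ioo_subset_Icc_self hε, hIoc ht⟩)
    intervalIntegrable_const
    (Filter.Eventually.of_forall fun t ht ε hε =>
      hder (ε, t) (hsub ⟨Ioo_subset_Icc_self hε, hIoc ht⟩))
  -- By uniqueness of derivatives `h'` agrees with the continuous `D (0, ·)` on `[a, b]`, so no
  -- regularity of `h'` has to be assumed.
  have heq : ∫ t in a..b, h' t = ∫ t in a..b, D (0, t) := by
    refine intervalIntegral.integral_congr fun t ht => ?_
    rw [uIcc_of_le hab.le] at ht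
    exact (hd t ht).unique (hder (0, t) (mem_strip_zero hδ ht))
  rw [heq]
  exact key.2

/-- A continuous function on `[a, b]` whose square has vanishing integral vanishes. -/
lemma eq_zero_of_integral_mul_self_eq_zero (hab : a < b) {f : ℝ → ℝ}
    (hf : ContinuousOn f (Icc a b)) (h : ∫ t in a..b, f t * f t = 0) :
    ∀ t ∈ Icc a b, f t = 0 := by
  by_contra! H
  obtain ⟨t, ht, hne⟩ := H
  have := intervalIntegral.integral_pos hab (f := fun t => f t * f t) (hf.mul hf)
    (fun t _ => mul_self_nonneg _) ⟨t, ht, mul_self_pos.2 hne⟩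
  exact this.ne' h

end StripCalculus

/-! ### Left translation and the trivialization of `TG` -/

section TangentBundleExt

variable {E : Type*} [NormedAddCommGroup E] [NormedSpace ℝ E]
  {H : Type*} [TopologicalSpace H] (I : ModelWithCorners ℝ E H)
  {M : Type*} [TopologicalSpace M] [ChartedSpace H M]

/-- All fibres are the model space `E`, so vectors over base points that are only propositionally
equal can be compared without transport. -/
lemma tangentBundle_ext {p q : M} (h : p = q) {v w : E} (hv : v = w) :
    (⟨p, v⟩ : TangentBundle I M) = ⟨q, w⟩ := by
  subst h hv; rfl

end TangentBundleExt

section LeftTranslation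

variable {E : Type*} [NormedAddCommGroup E] [NormedSpace ℝ E]
  {H : Type*} [TopologicalSpace H] (I : ModelWithCorners ℝ E H)
  {G : Type*} [TopologicalSpace G] [ChartedSpace H G] [Group G] [LieGroup I ∞ G]

lemma mdifferentiableAt_mul_left (g h : G) :
    MDifferentiableAt I I (fun x : G => g * x) h :=
  (contMDiff_mul_left (I := I) (n := ∞) (a := g)).contMDiffAt.mdifferentiableAt (by simp)

/-- The derivative of left multiplication composes as left multiplication does. -/
lemma mfderiv_mul_left_mul_left (g h k : G) (v : TangentSpace I k) :
    mfderiv I I (fun x : G => g * x) (h * k) (mfderiv I I (fun x : G => h * x) k v) =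
      mfderiv I I (fun x : G => g * h * x) k v := by
  have h1 : (fun x : G => g * h * x) = (fun x => g * x) ∘ fun x => h * x := by
    ext x; simp [mul_assoc]
  have h2 := mfderiv_comp (I' := I) k (mdifferentiableAt_mul_left I g (h * k))
    (mdifferentiableAt_mul_left I h k)
  rw [h1]
  exact (congrArg (fun D : E →L[ℝ] E => D v) h2).symm

/-- The left translation `ξ ↦ g ξ` as a continuous linear map between model spaces. -/
def leftTranslate (g : G) : E →L[ℝ] E := mfderiv I I (fun x : G => g * x) (1 : G)

/-- The left translation `v ↦ g⁻¹ v` as a continuous linear map between model spaces. -/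
def leftTranslateInv (g : G) : E →L[ℝ] E := mfderiv I I (fun x : G => g⁻¹ * x) g

lemma leftTranslateInv_leftTranslate (g : G) (ξ : E) :
    leftTranslateInv I g (leftTranslate I g ξ) = ξ := by
  have h1 : (fun x : G => g⁻¹ * g * x) = id := by ext x; simp
  have := mfderiv_mul_left_mul_left I g⁻¹ g 1 ξ
  rw [h1, mfderiv_id] at this
  rw [mul_one] at this
  exact this

lemma leftTranslate_leftTranslateInv (g : G) (v : E) :
    leftTranslate I g (leftTranslateInv I g v) = v := by
  have h1 : (fun x : G => g * g⁻¹ * x) = id := by ext x; simp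
  have := mfderiv_mul_left_mul_left I g g⁻¹ g v
  rw [h1, mfderiv_id] at this
  rw [inv_mul_cancel] at this
  exact this

/-- Left trivialization of the tangent bundle, `v_g ↦ g⁻¹ v_g`. -/
def maurerCartan (x : TangentBundle I G) : E := leftTranslateInv I x.proj x.2

/-- The trivialization centred at `g` is the derivative of the chart at `g`, which is the identity
on `T_gG`. -/
lemma trivializationAt_tangent_apply_self (g : G) (v : TangentSpace I g) :
    (trivializationAt E (TangentSpace I) g ⟨g, v⟩).2 = v := by
  have h1 := TangentBundle.continuousLinearMapAt_trivializationAt (I := I) (x₀ := g) (x := g)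
    (mem_chart_source H g)
  rw [mfderiv_extChartAt_self] at h1
  have h2 := (trivializationAt E (TangentSpace I) g).continuousLinearMapAt_apply_of_mem ℝ
    (FiberBundle.mem_baseSet_trivializationAt' g) v
  rw [h1] at h2
  exact h2.symm

/-- A map into the tangent bundle staying in a fixed fibre is smooth iff it is smooth as a map
into the model space. -/
lemma contMDiffWithinAt_fixed_fiber_iff {EM : Type*} [NormedAddCommGroup EM] [NormedSpace ℝ EM]
    {HM : Type*} [TopologicalSpace HM] {IM : ModelWithCorners ℝ EM HM} {M : Type*}
    [TopologicalSpace M] [ChartedSpace HM M] {g : G} {v : M → E} {s : Set M} {x : M} :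
    ContMDiffWithinAt IM I.tangent ∞ (fun m => (⟨g, v m⟩ : TangentBundle I G)) s x ↔
      ContMDiffWithinAt IM 𝓘(ℝ, E) ∞ v s x := by
  rw [contMDiffWithinAt_totalSpace]
  have : (fun m => (trivializationAt E (TangentSpace I) g (⟨g, v m⟩ : TangentBundle I G)).2) = v :=
    funext fun m => trivializationAt_tangent_apply_self I g (v m)
  simp only [this]
  exact and_iff_right contMDiffWithinAt_const

lemma contMDiff_maurerCartan : ContMDiff I.tangent 𝓘(ℝ, E) ∞ (maurerCartan I (G := G)) := by
  intro x₀
  have hf : ContMDiffAt (I.prod I) I ∞ (Function.uncurry fun g x : G => g⁻¹ * x)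
      (x₀.proj, x₀.proj) :=
    (contMDiff_fst.inv.mul contMDiff_snd).contMDiffAt
  have h1 := (ContMDiffAt.mfderiv (I := I) (I' := I) (m := ∞) (n := ∞)
    (fun g x : G => g⁻¹ * x) id hf contMDiffAt_id (by simp)).comp (x := x₀)
    (contMDiffAt_proj (TangentSpace I))
  -- This gives smoothness of `g⁻¹ v` as a point over `g⁻¹ * g`; rewriting the base point as `1`
  -- puts it in a fixed fibre, which is `E`.
  have h2 := ContMDiffAt.clm_apply_of_inCoordinates (IM := I.tangent) (F₁ := E) (F₂ := E)
    (E₁ := TangentSpace I (M := G)) (E₂ := TangentSpace I (M := G))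
    (b₁ := fun x : TangentBundle I G => x.proj)
    (b₂ := fun x : TangentBundle I G => x.proj⁻¹ * x.proj)
    (ϕ := fun x => mfderiv I I (fun y : G => x.proj⁻¹ * y) x.proj)
    (v := fun x => x.2) h1 contMDiffAt_id
    ((contMDiffAt_proj (TangentSpace I)).inv.mul (contMDiffAt_proj (TangentSpace I)))
  rw [← contMDiffWithinAt_univ, ← contMDiffWithinAt_fixed_fiber_iff I (g := (1 : G)),
    contMDiffWithinAt_univ]
  refine h2.congr_of_eventuallyEq (Filter.Eventually.of_forall fun x => ?_)
  exact tangentBundle_ext I (inv_mul_cancel x.proj).symm rfl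

/-- Inverse of the left trivialization of the tangent bundle. -/
def leftTranslateBundle (x : G × E) : TangentBundle I G := ⟨x.1, leftTranslate I x.1 x.2⟩

lemma contMDiff_leftTranslateBundle :
    ContMDiff (I.prod 𝓘(ℝ, E)) I.tangent ∞ (leftTranslateBundle I (G := G)) := by
  intro x₀
  have hf : ContMDiffAt (I.prod I) I ∞ (Function.uncurry fun g x : G => g * x)
      (x₀.1, 1) := (contMDiff_fst.mul contMDiff_snd).contMDiffAt
  have h1 := (ContMDiffAt.mfderiv (I := I) (I' := I) (m := ∞) (n := ∞)
    (fun g x : G => g * x) (fun _ => 1) hf contMDiffAt_const (by simp)).comp (x := x₀)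
    (contMDiffAt_fst (I := I) (J := 𝓘(ℝ, E)))
  have h3 : ContMDiffAt (I.prod 𝓘(ℝ, E)) I.tangent ∞
      (fun x : G × E => (⟨1, x.2⟩ : TangentBundle I G)) x₀ := by
    rw [← contMDiffWithinAt_univ, contMDiffWithinAt_fixed_fiber_iff I (g := (1 : G))]
    exact contMDiffWithinAt_snd
  have h2 := ContMDiffAt.clm_apply_of_inCoordinates (IM := I.prod 𝓘(ℝ, E)) (F₁ := E) (F₂ := E)
    (E₁ := TangentSpace I (M := G)) (E₂ := TangentSpace I (M := G))
    (b₁ := fun x : G × E => (1 : G))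
    (b₂ := fun x : G × E => x.1 * 1)
    (ϕ := fun x => mfderiv I I (fun y : G => x.1 * y) 1)
    (v := fun x => x.2) h1 h3
    (contMDiffAt_fst.mul contMDiffAt_const)
  refine h2.congr_of_eventuallyEq (Filter.Eventually.of_forall fun x => ?_)
  exact tangentBundle_ext I (mul_one x.1).symm rfl

/-! ### The trivialization of `TG ⊕ T*G` -/

/-- Smoothness of maps into the Pontryagin bundle is smoothness of both components. -/
lemma contMDiffWithinAt_pontryagin_iff {EM : Type*} [NormedAddCommGroup EM] [NormedSpace ℝ EM]
    {HM : Type*} [TopologicalSpace HM] {IM : ModelWithCorners ℝ EM HM} {M : Type*}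
    [TopologicalSpace M] [ChartedSpace HM M] {f : M → PontryaginBundle I G} {s : Set M} {x : M} :
    ContMDiffWithinAt IM (I.prod 𝓘(ℝ, E × (E →L[ℝ] ℝ))) ∞ f s x ↔
      ContMDiffWithinAt IM I.tangent ∞
        (fun m => (⟨(f m).proj, (f m).2.1⟩ : TangentBundle I G)) s x ∧
      ContMDiffWithinAt IM (I.prod 𝓘(ℝ, E →L[ℝ] ℝ)) ∞
        (fun m => (⟨(f m).proj, (f m).2.2⟩ : TotalSpace (E →L[ℝ] ℝ)
          fun y : G => TangentSpace I y →L[ℝ] ℝ)) s x := by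
  rw [contMDiffWithinAt_totalSpace, contMDiffWithinAt_totalSpace, contMDiffWithinAt_totalSpace,
    contMDiffWithinAt_prod_module_iff]
  constructor
  · rintro ⟨h1, h2, h3⟩
    exact ⟨⟨h1, h2⟩, h1, h3⟩
  · rintro ⟨⟨h1, h2⟩, -, h3⟩
    exact ⟨h1, h2, h3⟩

/-- In finite dimension, evaluation on a basis is a linear isomorphism from the dual of `E` onto
`ℝ^d`, so smoothness can be tested vector by vector. -/
lemma contDiffWithinAt_clm_of_apply [FiniteDimensional ℝ E] {V : Type*} [NormedAddCommGroup V]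
    [NormedSpace ℝ V] {f : V → E →L[ℝ] ℝ} {s : Set V} {x : V}
    (h : ∀ w, ContDiffWithinAt ℝ ∞ (fun y => f y w) s x) : ContDiffWithinAt ℝ ∞ f s x := by
  let d := Module.finrank ℝ E
  have hd : d = Module.finrank ℝ (Fin d → ℝ) := (Module.finrank_fin_fun ℝ).symm
  let e₁ := ContinuousLinearEquiv.ofFinrankEq hd
  let e₂ := (e₁.arrowCongr (1 : ℝ ≃L[ℝ] ℝ)).trans (ContinuousLinearEquiv.piRing (Fin d))
  rw [← Function.id_comp f, ← e₂.symm_comp_self]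
  exact e₂.symm.contDiff.contDiffWithinAt.comp x
    (contDiffWithinAt_pi.mpr fun i => h _) (mapsTo_univ _ _)

section Families

variable {V : Type*} [NormedAddCommGroup V] [NormedSpace ℝ V] {s : Set V}

/-- The left trivialization of a smooth family in the Pontryagin bundle is smooth. -/
lemma contMDiffOn_leftTrivialization [FiniteDimensional ℝ E] {f : V → PontryaginBundle I G}
    (hf : ContMDiffOn 𝓘(ℝ, V) (I.prod 𝓘(ℝ, E × (E →L[ℝ] ℝ))) ∞ f s) :
    ContMDiffOn 𝓘(ℝ, V) I ∞ (fun x => (leftTrivialization I (f x)).1) s ∧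
      ContDiffOn ℝ ∞ (F := E) (fun x => (leftTrivialization I (f x)).2.1) s ∧
      ContDiffOn ℝ ∞ (F := E →L[ℝ] ℝ) (fun x => (leftTrivialization I (f x)).2.2) s := by
  have hproj : ContMDiffOn 𝓘(ℝ, V) I ∞ (fun x => (f x).proj) s := fun x hx =>
    (contMDiffWithinAt_totalSpace.1 (hf x hx)).1
  refine ⟨hproj, ?_, ?_⟩
  · refine contMDiffOn_iff_contDiffOn (E' := E).1 fun x hx => ?_
    exact (contMDiff_maurerCartan I).contMDiffAt.comp_contMDiffWithinAt x
      ((contMDiffWithinAt_pontryagin_iff I).1 (hf x hx)).1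
  · intro x hx
    refine contDiffWithinAt_clm_of_apply (E := E) fun w => ?_
    have h1 := ((contMDiffWithinAt_pontryagin_iff I).1 (hf x hx)).2
    have h2 : ContMDiffWithinAt 𝓘(ℝ, V) I.tangent ∞
        (fun m => leftTranslateBundle I ((f m).proj, w)) s x :=
      (contMDiff_leftTranslateBundle I).contMDiffAt.comp_contMDiffWithinAt x
        ((hproj x hx).prodMk contMDiffWithinAt_const)
    -- `⟨g⁻¹ p, w⟩ = ⟨p, g w⟩` pairs a smooth covector with a smooth vector over the same base
    -- point.
    have h3 := ContMDiffWithinAt.clm_bundle_apply (F₁ := E) (F₂ := ℝ)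
      (E₁ := TangentSpace I (M := G)) (E₂ := Bundle.Trivial G ℝ)
      (b := fun m => (f m).proj) (ϕ := fun m => (f m).2.2)
      (v := fun m => leftTranslate I (f m).proj w) h1 h2
    exact contMDiffWithinAt_iff_contDiffWithinAt.1 (contMDiffWithinAt_totalSpace.1 h3).2

/-- Inverse of the left trivialization of the Pontryagin bundle. -/
def leftTrivializationSymm (x : G × GroupLieAlgebra I G × (GroupLieAlgebra I G →L[ℝ] ℝ)) :
    PontryaginBundle I G :=
  ⟨x.1, (leftTranslate (E := E) I x.1 x.2.1,
    ContinuousLinearMap.comp (M₁ := E) (M₂ := E) x.2.2 (leftTranslateInv (E := E) I x.1))⟩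

lemma leftTrivialization_symm (x : G × GroupLieAlgebra I G × (GroupLieAlgebra I G →L[ℝ] ℝ)) :
    leftTrivialization I (leftTrivializationSymm I x) = x := by
  obtain ⟨g, ξ, μ⟩ := x
  refine Prod.ext rfl (Prod.ext ?_ ?_)
  · exact leftTranslateInv_leftTranslate I g ξ
  · refine ContinuousLinearMap.ext fun w => ?_
    exact congrArg μ (leftTranslateInv_leftTranslate I g w)

lemma contMDiffOn_leftTrivializationSymm [FiniteDimensional ℝ E]
    {f : V → G × GroupLieAlgebra I G × (GroupLieAlgebra I G →L[ℝ] ℝ)}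
    (h1 : ContMDiffOn 𝓘(ℝ, V) I ∞ (fun x => (f x).1) s)
    (h2 : ContDiffOn ℝ ∞ (F := E) (fun x => (f x).2.1) s)
    (h3 : ContDiffOn ℝ ∞ (F := E →L[ℝ] ℝ) (fun x => (f x).2.2) s) :
    ContMDiffOn 𝓘(ℝ, V) (I.prod 𝓘(ℝ, E × (E →L[ℝ] ℝ))) ∞
      (fun x => leftTrivializationSymm I (f x)) s := by
  intro x hx
  refine (contMDiffWithinAt_pontryagin_iff I).2 ⟨?_, ?_⟩
  · exact (contMDiff_leftTranslateBundle I).contMDiffAt.comp_contMDiffWithinAt x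
      ((h1 x hx).prodMk (contMDiffWithinAt_iff_contDiffWithinAt.2 (h2 x hx)))
  · refine (contMDiffWithinAt_hom_bundle _).2 ⟨h1 x hx, ?_⟩
    refine contMDiffWithinAt_iff_contDiffWithinAt.2
      (contDiffWithinAt_clm_of_apply (E := E) fun w => ?_)
    set e := trivializationAt E (TangentSpace I) (f x).1 with he
    have hmem : (f x).1 ∈ e.baseSet := FiberBundle.mem_baseSet_trivializationAt' _
    have h4 : ContMDiffWithinAt 𝓘(ℝ, V) I.tangent ∞
        (fun y => e.toOpenPartialHomeomorph.symm ((f y).1, w)) s x :=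
      ((e.contMDiffOn_symm (n := ∞) (IB := I)).contMDiffAt
        (e.open_target.mem_nhds (e.mem_target.2 hmem))).comp_contMDiffWithinAt x
        ((h1 x hx).prodMk contMDiffWithinAt_const)
    -- In the trivialization `e`, the covector `v ↦ μ (g⁻¹ v)` takes the value `μ (g⁻¹ e⁻¹(g, w))`
    -- at `w`; this is `μ` applied to the smooth function here.
    have h5 : ContDiffWithinAt ℝ ∞ (fun y => maurerCartan I
        (e.toOpenPartialHomeomorph.symm ((f y).1, w))) s x :=
      contMDiffWithinAt_iff_contDiffWithinAt.1
        ((contMDiff_maurerCartan I).contMDiffAt.comp_contMDiffWithinAt x h4)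
    refine (ContDiffWithinAt.clm_apply (F := E) (h3 x hx) h5).congr_of_eventuallyEq_of_mem ?_ hx
    filter_upwards [(h1 x hx).continuousWithinAt (e.open_baseSet.mem_nhds hmem)] with y hy
    have h6 : e.toOpenPartialHomeomorph.symm ((f y).1, w) =
        (⟨(f y).1, e.symmL ℝ (f y).1 w⟩ : TangentBundle I G) := by
      rw [e.symmL_apply hy, e.mk_symm hy]
    rw [h6]
    exact congrArg (fun D : ℝ →L[ℝ] ℝ => D ((f y).2.2 (maurerCartan (E := E) I
      (⟨(f y).1, e.symmL ℝ (f y).1 w⟩ : TangentBundle I G))))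
      (Bundle.Trivial.continuousLinearMapAt_trivialization ℝ G ℝ (f y).1)

end Families

end LeftTranslation

/-! ### The Maurer-Cartan equation -/

section MaurerCartanEquation

open scoped Topology
open VectorField

variable {E : Type*} [NormedAddCommGroup E] [NormedSpace ℝ E]
  {H : Type*} [TopologicalSpace H] (I : ModelWithCorners ℝ E H)
  {G : Type*} [TopologicalSpace G] [ChartedSpace H G] [Group G] [LieGroup I ∞ G]
  {V : Type*} [NormedAddCommGroup V] [NormedSpace ℝ V]

/-- The left-trivialized derivative `f(x)⁻¹ df_x(w)` of a map from a vector space to `G`. -/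
def reducedDerivWithin (s : Set V) (f : V → G) (x w : V) : E :=
  leftTranslateInv I (f x) (mfderivWithin 𝓘(ℝ, V) I f s x w)

/-- The function is the constant section `w`, followed by the tangent map of `f` and the
Maurer-Cartan form. -/
lemma contDiffOn_reducedDerivWithin {s : Set V} (hs : UniqueDiffOn ℝ s) {f : V → G}
    (hf : ContMDiffOn 𝓘(ℝ, V) I ∞ f s) (w : V) :
    ContDiffOn ℝ ∞ (fun x => reducedDerivWithin I s f x w) s := by
  have h1 := hf.contMDiffOn_tangentMapWithin (m := ∞) (by simp) hs.uniqueMDiffOn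
  have h2 : ContMDiffOn 𝓘(ℝ, V) 𝓘(ℝ, V).tangent ∞
      (fun x => (⟨x, w⟩ : TangentBundle 𝓘(ℝ, V) V)) s :=
    contMDiffOn_vectorSpace_iff_contDiffOn.2 contDiffOn_const
  exact contMDiffOn_iff_contDiffOn.1
    ((contMDiff_maurerCartan I).comp_contMDiffOn (h1.comp h2 fun x hx => hx))

/-- The left translation `ξ ↦ φ⁻¹(y) ξ` read in the chart `φ` at `g₀`. -/
def leftTranslateInChart (g₀ : G) (x : E × E) : E :=
  (trivializationAt E (TangentSpace I) g₀
    (leftTranslateBundle I ((extChartAt I g₀).symm x.1, x.2))).2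

lemma leftTranslateInChart_eq {g₀ : G} {y : E} (hy : y ∈ (extChartAt I g₀).target) (ξ : E) :
    leftTranslateInChart I g₀ (y, ξ) =
      mfderiv I 𝓘(ℝ, E) (extChartAt I g₀) ((extChartAt I g₀).symm y)
        (leftTranslate I ((extChartAt I g₀).symm y) ξ) := by
  have hs : (extChartAt I g₀).symm y ∈ (chartAt H g₀).source := by
    rw [← extChartAt_source I]; exact (extChartAt I g₀).map_target hy
  have h1 := TangentBundle.continuousLinearMapAt_trivializationAt (I := I) hs
  have h2 := (trivializationAt E (TangentSpace I) g₀).continuousLinearMapAt_apply_of_mem ℝ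
    (b := (extChartAt I g₀).symm y) (by simpa using hs)
    (leftTranslate I ((extChartAt I g₀).symm y) ξ)
  rw [h1] at h2
  exact h2.symm

lemma leftTranslateInChart_self (g₀ : G) (ξ : E) :
    leftTranslateInChart I g₀ (extChartAt I g₀ g₀, ξ) = leftTranslate I g₀ ξ := by
  rw [leftTranslateInChart, extChartAt_to_inv]
  exact trivializationAt_tangent_apply_self I g₀ _

lemma contDiffAt_leftTranslateInChart [I.Boundaryless] (g₀ : G) (ξ : E) :
    ContDiffAt ℝ ∞ (leftTranslateInChart I g₀) (extChartAt I g₀ g₀, ξ) := by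
  have h1 : ContMDiffAt 𝓘(ℝ, E) I ∞ (extChartAt I g₀).symm (extChartAt I g₀ g₀) :=
    (contMDiffOn_extChartAt_symm g₀).contMDiffAt (extChartAt_target_mem_nhds g₀)
  have h2 : ContMDiffAt 𝓘(ℝ, E × E) I.tangent ∞
      (fun x : E × E => leftTranslateBundle I ((extChartAt I g₀).symm x.1, x.2))
      (extChartAt I g₀ g₀, ξ) :=
    (contMDiff_leftTranslateBundle I).contMDiffAt.comp _
      ((h1.comp (extChartAt I g₀ g₀, ξ) contDiffAt_fst.contMDiffAt).prodMk
        contDiffAt_snd.contMDiffAt)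
  have h3 := (contMDiffAt_totalSpace.1 h2).2
  simp only [leftTranslateBundle, extChartAt_to_inv] at h3
  exact contMDiffAt_iff_contDiffAt.1 h3

/-- Pulling back along `φ⁻¹` applies the inverse of `d(φ⁻¹)`, that is `dφ`. This links the bracket,
defined by left-invariant fields, to `leftTranslateInChart`. -/
lemma mpullbackWithin_extChartAt_symm_mulInvariantVectorField {g₀ : G} {y : E}
    (hy : y ∈ (extChartAt I g₀).target) (ξ : E) :
    mpullbackWithin 𝓘(ℝ, E) I (extChartAt I g₀).symm
        (mulInvariantVectorField (I := I) (G := G) ξ) (range I) y =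
      leftTranslateInChart I g₀ (y, ξ) := by
  rw [leftTranslateInChart_eq I hy, mpullbackWithin_apply]
  have := ContinuousLinearMap.inverse_eq
    (mfderivWithin_extChartAt_symm_comp_mfderiv_extChartAt hy)
    (mfderiv_extChartAt_comp_mfderivWithin_extChartAt_symm hy)
  rw [this]
  rfl

variable (G) in
/-- The Lie bracket of the Lie algebra of `G`, on the model space. -/
def bracketModel (ξ η : E) : E :=
  Bracket.bracket (L := GroupLieAlgebra I G) (M := GroupLieAlgebra I G) ξ η

/-- The Lie bracket of the Lie algebra, in terms of left translations read in a chart. -/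
lemma leftTranslate_bracket [CompleteSpace E] [I.Boundaryless] (g₀ : G) (ξ η : E) :
    leftTranslate I g₀ (bracketModel I G ξ η) =
      fderiv ℝ (leftTranslateInChart I g₀) (extChartAt I g₀ g₀, η) (leftTranslate I g₀ ξ, 0) -
      fderiv ℝ (leftTranslateInChart I g₀) (extChartAt I g₀ g₀, ξ) (leftTranslate I g₀ η, 0) := by
  have : LieGroup I (minSmoothness ℝ 3) G := by
    rw [minSmoothness_of_isRCLikeNormedField]; infer_instance
  have h1 := congrFun (mulInvariantVector_mlieBracket (I := I) (G := G) ξ η) g₀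
  have h1' := mlieBracketWithin_apply (I := I) (s := univ) (x₀ := g₀)
    (V := mulInvariantVectorField (I := I) (G := G) ξ)
    (W := mulInvariantVectorField (I := I) (G := G) η)
  rw [mfderiv_extChartAt_self, mlieBracketWithin_univ] at h1'
  -- In the chart `[V, W] = DW(V) - DV(W)`, and differentiating the field of `ζ` means
  -- differentiating `leftTranslateInChart` in its first variable only.
  have h2 : ∀ ζ v : E, fderivWithin ℝ (mpullbackWithin 𝓘(ℝ, E) I (extChartAt I g₀).symm
        (mulInvariantVectorField (I := I) (G := G) ζ) (range I)) univ (extChartAt I g₀ g₀) v =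
      fderiv ℝ (leftTranslateInChart I g₀) (extChartAt I g₀ g₀, ζ) (v, 0) := by
    intro ζ v
    have h3 : (fun y => leftTranslateInChart I g₀ (y, ζ)) =ᶠ[𝓝 (extChartAt I g₀ g₀)]
        mpullbackWithin 𝓘(ℝ, E) I (extChartAt I g₀).symm
          (mulInvariantVectorField (I := I) (G := G) ζ) (range I) := by
      filter_upwards [extChartAt_target_mem_nhds (I := I) g₀] with y hy
      exact (mpullbackWithin_extChartAt_symm_mulInvariantVectorField I hy ζ).symm
    have h4 := ((contDiffAt_leftTranslateInChart I g₀ ζ).differentiableAt (by simp)).hasFDerivAt.comp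
      (f := fun y => (y, ζ)) (extChartAt I g₀ g₀)
      ((hasFDerivAt_id (𝕜 := ℝ) (extChartAt I g₀ g₀)).prodMk (hasFDerivAt_const ζ _))
    have h5 := (h4.congr_of_eventuallyEq h3.symm).hasFDerivWithinAt.fderivWithin
      uniqueDiffWithinAt_univ
    refine (congrArg (fun D : E →L[ℝ] E => D v) h5).trans ?_
    simp
  have h6 : ∀ ζ : E, mpullbackWithin 𝓘(ℝ, E) I (extChartAt I g₀).symm
        (mulInvariantVectorField (I := I) (G := G) ζ) (range I) (extChartAt I g₀ g₀) =
      leftTranslate I g₀ ζ := fun ζ => by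
    rw [← leftTranslateInChart_self]
    exact mpullbackWithin_extChartAt_symm_mulInvariantVectorField I (mem_extChartAt_target g₀) ζ
  rw [← h2, ← h2, ← h6 ξ, ← h6 η]
  refine (Eq.trans h1 h1').trans ?_
  have h7 : ((extChartAt I g₀).symm ⁻¹' univ ∩ range I : Set E) = univ := by
    simp [I.range_eq_univ]
  rw [h7]
  exact congrArg (fun D : E →L[ℝ] E => D _) (ContinuousLinearMap.inverse_id (R := ℝ) (M := E))

/-- The Maurer-Cartan equation for a smooth map from a subset of a vector space to `G`. -/
lemma maurerCartan_equation [CompleteSpace E] [I.Boundaryless] {s : Set V}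
    (hs : UniqueDiffOn ℝ s) {f : V → G} (hf : ContMDiffOn 𝓘(ℝ, V) I ∞ f s) {x₀ : V}
    (hx : x₀ ∈ s) (hx' : x₀ ∈ closure (interior s)) (w w' : V) :
    fderivWithin ℝ (fun x => reducedDerivWithin I s f x w') s x₀ w =
      fderivWithin ℝ (fun x => reducedDerivWithin I s f x w) s x₀ w' +
      bracketModel I G (reducedDerivWithin I s f x₀ w') (reducedDerivWithin I s f x₀ w) := by
  set g₀ := f x₀ with hg₀
  set φ := extChartAt I g₀ with hφ
  set u : V → E := fun x => φ (f x) with hu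
  set K := leftTranslateInChart I g₀ with hK
  have hsrc : ∀ᶠ x in 𝓝[s] x₀, f x ∈ φ.source :=
    (hf x₀ hx).continuousWithinAt (extChartAt_source_mem_nhds (I := I) g₀)
  have hus : ContDiffWithinAt ℝ ∞ u s x₀ :=
    contMDiffWithinAt_iff_contDiffWithinAt.1
      ((contMDiffAt_extChartAt (n := ∞)).comp_contMDiffWithinAt x₀ (hf x₀ hx))
  -- derivative of `u`
  have hdu : ∀ x ∈ s, f x ∈ φ.source → ∀ z : V,
      fderivWithin ℝ u s x z = K (u x, reducedDerivWithin I s f x z) := by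
    intro x hxs hxφ z
    have h1 : HasMFDerivWithinAt 𝓘(ℝ, V) I f s x (mfderivWithin 𝓘(ℝ, V) I f s x) :=
      ((hf x hxs).mdifferentiableWithinAt (by simp)).hasMFDerivWithinAt
    have h2 := (mdifferentiableAt_extChartAt (I := I) (x := g₀) (y := f x)
      (by simpa [hφ] using hxφ)).hasMFDerivAt
    obtain ⟨D, hD, h3⟩ : ∃ D : V →L[ℝ] E, (∀ z, D z = (mfderiv I 𝓘(ℝ, E) φ (f x) : E →L[ℝ] E)
        (mfderivWithin 𝓘(ℝ, V) I f s x z)) ∧ HasFDerivWithinAt u D s x :=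
      ⟨_, fun _ => rfl, (h2.comp_hasMFDerivWithinAt x h1).hasFDerivWithinAt⟩
    rw [h3.fderivWithin (hs x hxs), hD]
    have h6 := leftTranslateInChart_eq I (φ.map_source hxφ) (reducedDerivWithin I s f x z)
    have h7 : φ.symm (φ (f x)) = f x := φ.left_inv hxφ
    rw [h7] at h6
    refine Eq.trans ?_ h6.symm
    exact congrArg (fun v : E => (mfderiv I 𝓘(ℝ, E) φ (f x) : E →L[ℝ] E) v)
      (leftTranslate_leftTranslateInv I (f x) (mfderivWithin 𝓘(ℝ, V) I f s x z : E)).symm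
  have hθ : ∀ z, DifferentiableWithinAt ℝ (fun x => reducedDerivWithin I s f x z) s x₀ :=
    fun z => (contDiffOn_reducedDerivWithin I hs hf z).differentiableOn (by simp) x₀ hx
  have hKd : ∀ ξ : E, DifferentiableAt ℝ K (u x₀, ξ) := fun ξ =>
    (contDiffAt_leftTranslateInChart I g₀ ξ).differentiableAt (by simp)
  -- second derivative of `u`
  have hd2 : ∀ z z' : V, fderivWithin ℝ (fderivWithin ℝ u s) s x₀ z z' =
      fderiv ℝ K (u x₀, reducedDerivWithin I s f x₀ z')
        (leftTranslate I g₀ (reducedDerivWithin I s f x₀ z), 0) +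
      leftTranslate I g₀ (fderivWithin ℝ (fun x => reducedDerivWithin I s f x z') s x₀ z) := by
    intro z z'
    have h1 : DifferentiableWithinAt ℝ (fderivWithin ℝ u s) s x₀ :=
      (hus.fderivWithin_right (m := 1) hs (by norm_cast) hx).differentiableWithinAt (by simp)
    have h2 : HasFDerivWithinAt (fun x => fderivWithin ℝ u s x z')
        ((fderivWithin ℝ (fderivWithin ℝ u s) s x₀).flip z') s x₀ :=
      (ContinuousLinearMap.apply ℝ E z').hasFDerivAt.comp_hasFDerivWithinAt x₀
        h1.hasFDerivWithinAt
    have h3 : HasFDerivWithinAt (fun x => K (u x, reducedDerivWithin I s f x z'))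
        ((fderiv ℝ K (u x₀, reducedDerivWithin I s f x₀ z')).comp
          ((fderivWithin ℝ u s x₀).prod
            (fderivWithin ℝ (fun x => reducedDerivWithin I s f x z') s x₀))) s x₀ :=
      (hKd (reducedDerivWithin I s f x₀ z')).hasFDerivAt.comp_hasFDerivWithinAt
        (f := fun x => (u x, reducedDerivWithin I s f x z')) x₀
        ((hus.differentiableWithinAt (by simp)).hasFDerivWithinAt.prodMk
          (hθ z').hasFDerivWithinAt)
    have h4 : (fun x => fderivWithin ℝ u s x z') =ᶠ[𝓝[s] x₀]
        fun x => K (u x, reducedDerivWithin I s f x z') := by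
      filter_upwards [hsrc, self_mem_nhdsWithin] with x hxφ hxs using hdu x hxs hxφ z'
    have h5 := (h2.fderivWithin (hs x₀ hx)).symm.trans
      ((h3.congr_of_eventuallyEq h4 (h4.eq_of_nhdsWithin hx)).fderivWithin (hs x₀ hx))
    have h6 := congrArg (fun D : V →L[ℝ] E => D z) h5
    simp only [ContinuousLinearMap.flip_apply, ContinuousLinearMap.comp_apply,
      ContinuousLinearMap.prod_apply] at h6
    have h7 := hdu x₀ hx (mem_extChartAt_source g₀) z
    rw [hK, leftTranslateInChart_self I g₀] at h7
    rw [h6, h7, ← add_zero (leftTranslate I g₀ _),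
      ← zero_add (fderivWithin ℝ (fun x => reducedDerivWithin I s f x z') s x₀ z),
      ← Prod.mk_add_mk, map_add, add_zero, zero_add]
    congr 1
    -- `K` is linear in the second variable
    have h8 : HasFDerivAt (fun ξ : E => K (u x₀, ξ)) (leftTranslate I g₀)
        (reducedDerivWithin I s f x₀ z') := by
      have : (fun ξ : E => K (u x₀, ξ)) = leftTranslate I g₀ :=
        funext fun ξ => leftTranslateInChart_self I g₀ ξ
      rw [this]
      exact (leftTranslate I g₀).hasFDerivAt
    have h9 := (hKd (reducedDerivWithin I s f x₀ z')).hasFDerivAt.comp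
      (reducedDerivWithin I s f x₀ z')
      ((hasFDerivAt_const (u x₀) _).prodMk (hasFDerivAt_id _))
    have h10 := congrArg (fun D : E →L[ℝ] E =>
      D (fderivWithin ℝ (fun x => reducedDerivWithin I s f x z') s x₀ z)) (h9.unique h8)
    simpa using h10
  -- Symmetry of `d²u` equates the two expansions: the first-variable terms differ by the left
  -- translate of the bracket, and `leftTranslate` is injective.
  have hsymm := (hus.isSymmSndFDerivWithinAt (by simp; norm_cast) hs hx' hx) w w'
  rw [hd2, hd2] at hsymm
  have hbr := leftTranslate_bracket I g₀ (reducedDerivWithin I s f x₀ w')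
    (reducedDerivWithin I s f x₀ w)
  have hinj : Function.Injective (leftTranslate (E := E) I g₀) := fun v v' h => by
    rw [← leftTranslateInv_leftTranslate I g₀ v, h, leftTranslateInv_leftTranslate]
  apply hinj
  change _ = fderiv ℝ K (u x₀, _) _ - fderiv ℝ K (u x₀, _) _ at hbr
  rw [map_add, hbr, ← add_sub_assoc, eq_sub_iff_add_eq, add_comm, hsymm, add_comm]

end MaurerCartanEquation

/-! ### Families of curves and first variations -/

section FamiliesOfCurves

open scoped Topology

variable {E : Type*} [NormedAddCommGroup E] [NormedSpace ℝ E]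
  {H : Type*} [TopologicalSpace H] (I : ModelWithCorners ℝ E H)
  {G : Type*} [TopologicalSpace G] [ChartedSpace H G]
  {δ a b : ℝ}

lemma mdifferentiableAt_param {γ : ℝ → ℝ → G}
    (hγ : SmoothFamily I δ a b γ) {x : ℝ × ℝ} (hx : x ∈ strip δ a b) :
    MDifferentiableAt 𝓘(ℝ, ℝ) I (fun ε => γ ε x.2) x.1 := by
  have h1 : ContMDiffOn 𝓘(ℝ, ℝ) I ∞ (fun ε => γ ε x.2) (Ioo (-δ) δ) :=
    ContMDiffOn.comp (g := fun y : ℝ × ℝ => γ y.1 y.2) (f := fun ε : ℝ => (ε, x.2)) hγ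
      (contDiff_id.prodMk contDiff_const).contMDiff.contMDiffOn fun ε hε => ⟨hε, hx.2⟩
  exact (h1.contMDiffAt (isOpen_Ioo.mem_nhds hx.1)).mdifferentiableAt (by simp)

lemma smoothFamily_const {g : ℝ → G} (hg : ContMDiffOn 𝓘(ℝ, ℝ) I ∞ g (Icc a b)) :
    SmoothFamily I δ a b (fun _ => g) :=
  ContMDiffOn.comp (f := fun y : ℝ × ℝ => y.2) hg contDiff_snd.contMDiff.contMDiffOn
    fun _ hx => hx.2

lemma contDiffOn_lagrangian {l : G → E → ℝ}
    (hl : ContMDiff (I.prod 𝓘(ℝ, E)) 𝓘(ℝ, ℝ) ∞ fun x : G × E => l x.1 x.2)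
    {γ : ℝ → ℝ → G} {ζ : ℝ → ℝ → E} (hγ : SmoothFamily I δ a b γ)
    (hζ : ContDiffOn ℝ ∞ (fun x : ℝ × ℝ => ζ x.1 x.2) (strip δ a b)) :
    ContDiffOn ℝ ∞ (fun x : ℝ × ℝ => l (γ x.1 x.2) (ζ x.1 x.2)) (strip δ a b) :=
  contMDiffOn_iff_contDiffOn.1 (hl.comp_contMDiffOn (ContMDiffOn.prodMk hγ hζ.contMDiffOn))

variable [Group G]

/-- Velocities are derivatives within `[a, b]`, so values of the curves outside it are irrelevant.
-/
lemma reducedVelocity_congr {g g' : ℝ → G} (h : ∀ t ∈ Icc a b, g t = g' t) {t : ℝ}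
    (ht : t ∈ Icc a b) : (reducedVelocity I a b g t : E) = reducedVelocity I a b g' t := by
  have h1 : (mfderivWithin 𝓘(ℝ, ℝ) I g (Icc a b) t : ℝ →L[ℝ] E) =
      mfderivWithin 𝓘(ℝ, ℝ) I g' (Icc a b) t := mfderivWithin_congr h (h t ht)
  have h2 : (leftTranslateInv I (g t) : E →L[ℝ] E) = leftTranslateInv I (g' t) := by rw [h t ht]
  change (leftTranslateInv I (g t) : E →L[ℝ] E)
      ((mfderivWithin 𝓘(ℝ, ℝ) I g (Icc a b) t : ℝ →L[ℝ] E) 1) =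
    (leftTranslateInv I (g' t) : E →L[ℝ] E)
      ((mfderivWithin 𝓘(ℝ, ℝ) I g' (Icc a b) t : ℝ →L[ℝ] E) 1)
  rw [h1, h2]
  rfl

/-- The reduced velocity of a curve of a smooth family. -/
lemma reducedVelocity_eq_reducedDerivWithin (hab : a < b) {γ : ℝ → ℝ → G}
    (hγ : SmoothFamily I δ a b γ) {x : ℝ × ℝ} (hx : x ∈ strip δ a b) :
    (reducedVelocity I a b (γ x.1) x.2 : E) =
      reducedDerivWithin I (strip δ a b) (fun y => γ y.1 y.2) x (0, 1) := by
  have h1 := ((hγ x hx).mdifferentiableWithinAt (by simp)).hasMFDerivWithinAt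
  have h2 : HasFDerivWithinAt (fun t : ℝ => (x.1, t)) (ContinuousLinearMap.inr ℝ ℝ ℝ)
      (Icc a b) x.2 := (hasFDerivAt_prodMk_right x.1 x.2).hasFDerivWithinAt
  have h3 := HasMFDerivWithinAt.comp x.2 (f := fun t : ℝ => (x.1, t)) h1
    h2.hasMFDerivWithinAt (fun t ht => ⟨hx.1, ht⟩)
  have h4 := h3.mfderivWithin ((uniqueDiffOn_Icc hab).uniqueMDiffOn x.2 hx.2)
  exact congrArg (fun D : ℝ →L[ℝ] E => leftTranslateInv I (γ x.1 x.2) (D 1)) h4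

/-- The infinitesimal variation of a smooth family. -/
lemma infinitesimalVariation_eq_reducedDerivWithin (hδ : 0 < δ) {γ : ℝ → ℝ → G}
    (hγ : SmoothFamily I δ a b γ) {t : ℝ} (ht : t ∈ Icc a b) :
    (infinitesimalVariation I γ t : E) =
      reducedDerivWithin I (strip δ a b) (fun y => γ y.1 y.2) (0, t) (1, 0) := by
  have hx := mem_strip_zero hδ ht
  have h1 := ((hγ _ hx).mdifferentiableWithinAt (by simp)).hasMFDerivWithinAt
  have h2 : HasFDerivWithinAt (fun ε : ℝ => (ε, t)) (ContinuousLinearMap.inl ℝ ℝ ℝ)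
      (Ioo (-δ) δ) 0 := (hasFDerivAt_prodMk_left 0 t).hasFDerivWithinAt
  have h3 := HasMFDerivWithinAt.comp (0 : ℝ) (f := fun ε : ℝ => (ε, t)) h1
    h2.hasMFDerivWithinAt (fun ε hε => ⟨hε, ht⟩)
  have h4 := (h3.hasMFDerivAt (isOpen_Ioo.mem_nhds hx.1)).mfderiv
  exact congrArg (fun D : ℝ →L[ℝ] E => leftTranslateInv I (γ 0 t) (D 1)) h4

lemma infinitesimalVariation_const (g : ℝ → G) (t : ℝ) :
    (infinitesimalVariation I (fun _ => g) t : E) = 0 := by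
  have h : (mfderiv 𝓘(ℝ, ℝ) I (fun _ : ℝ => g t) 0 : ℝ →L[ℝ] E) = 0 := mfderiv_const
  exact (congrArg (fun D : ℝ →L[ℝ] E => leftTranslateInv I (g t) (D 1)) h).trans (map_zero _)

lemma infinitesimalVariation_eq_zero {γ : ℝ → ℝ → G} {t δ : ℝ} {p : G} (hδ : 0 < δ)
    (h : ∀ ε ∈ Ioo (-δ) δ, γ ε t = p) : (infinitesimalVariation I γ t : E) = 0 := by
  have h1 : (fun ε => γ ε t) =ᶠ[𝓝 0] fun _ => p :=
    Filter.eventually_of_mem (Ioo_mem_nhds (neg_lt_zero.2 hδ) hδ) h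
  have h2 : (mfderiv 𝓘(ℝ, ℝ) I (fun ε => γ ε t) 0 : ℝ →L[ℝ] E) = 0 :=
    h1.mfderiv_eq.trans mfderiv_const
  exact (congrArg (fun D : ℝ →L[ℝ] E => leftTranslateInv I (γ 0 t) (D 1)) h2).trans (map_zero _)

variable [LieGroup I ∞ G]

lemma contDiffOn_reducedVelocity_family (hab : a < b) {γ : ℝ → ℝ → G}
    (hγ : SmoothFamily I δ a b γ) :
    ContDiffOn ℝ ∞ (F := E) (fun x : ℝ × ℝ => reducedVelocity I a b (γ x.1) x.2)
      (strip δ a b) :=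
  ContDiffOn.congr (F := E)
    (contDiffOn_reducedDerivWithin I (uniqueDiffOn_strip hab) hγ ((0, 1) : ℝ × ℝ))
    fun _ hx => reducedVelocity_eq_reducedDerivWithin I hab hγ hx

lemma contDiffOn_reducedVelocity (hab : a < b) {g : ℝ → G}
    (hg : ContMDiffOn 𝓘(ℝ, ℝ) I ∞ g (Icc a b)) :
    ContDiffOn ℝ ∞ (F := E) (reducedVelocity I a b g) (Icc a b) :=
  contDiffOn_slice one_pos (contDiffOn_reducedVelocity_family I hab (smoothFamily_const I hg))

lemma contDiffOn_infinitesimalVariation (hab : a < b) (hδ : 0 < δ) {γ : ℝ → ℝ → G}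
    (hγ : SmoothFamily I δ a b γ) :
    ContDiffOn ℝ ∞ (F := E) (infinitesimalVariation I γ) (Icc a b) :=
  ContDiffOn.congr (F := E) (contDiffOn_slice hδ
    (contDiffOn_reducedDerivWithin I (uniqueDiffOn_strip hab) hγ ((1, 0) : ℝ × ℝ)))
    fun _ ht => infinitesimalVariation_eq_reducedDerivWithin I hδ hγ ht

/-- The variation of the reduced velocity: `δξ = η̇ + ad_ξ η`. -/
lemma hasDerivAt_reducedVelocity [CompleteSpace E] [I.Boundaryless] (hab : a < b) (hδ : 0 < δ)
    {γ : ℝ → ℝ → G} (hγ : SmoothFamily I δ a b γ) {t : ℝ} (ht : t ∈ Icc a b) :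
    HasDerivAt (F := E) (fun ε => reducedVelocity I a b (γ ε) t)
      (derivWithin (F := E) (infinitesimalVariation I γ) (Icc a b) t +
        bracketModel I G (reducedVelocity I a b (γ 0) t) (infinitesimalVariation I γ t)) 0 := by
  have hx := mem_strip_zero hδ ht
  have hs : UniqueDiffOn ℝ (strip δ a b) := uniqueDiffOn_strip hab
  have hd : ∀ w : ℝ × ℝ, DifferentiableWithinAt ℝ
      (fun x => reducedDerivWithin I (strip δ a b) (fun y => γ y.1 y.2) x w) (strip δ a b) (0, t) :=
    fun w => (contDiffOn_reducedDerivWithin I hs hγ w).differentiableOn (by simp) _ hx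
  have h1 := hasDerivAt_param_of_differentiableWithinAt (hd (0, 1)) hx
  have h2 := hasDerivWithinAt_time_of_differentiableWithinAt (hd (1, 0)) hx
  -- The direction `(1, 0)` is `∂/∂ε`, giving `η`, and `(0, 1)` is `∂/∂t`, giving `ξ`.
  have h3 := maurerCartan_equation I hs hγ hx (strip_subset_closure_interior hab hx)
    (1, 0) (0, 1)
  have h4 : derivWithin (F := E) (infinitesimalVariation I γ) (Icc a b) t =
      fderivWithin ℝ (fun x => reducedDerivWithin I (strip δ a b) (fun y => γ y.1 y.2) x (1, 0))
        (strip δ a b) (0, t) (0, 1) :=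
    HasDerivWithinAt.derivWithin (F := E)
      (HasDerivWithinAt.congr (F := E) h2
        (fun _ ht' => infinitesimalVariation_eq_reducedDerivWithin I hδ hγ ht')
        (infinitesimalVariation_eq_reducedDerivWithin I hδ hγ ht))
      (uniqueDiffOn_Icc hab t ht)
  have h5 := infinitesimalVariation_eq_reducedDerivWithin I hδ hγ ht
  have h6 := reducedVelocity_eq_reducedDerivWithin I hab hγ hx
  rw [h4]
  refine Eq.mp ?_ (HasDerivAt.congr_of_eventuallyEq (F := E) h1
    (Filter.eventually_of_mem (isOpen_Ioo.mem_nhds hx.1) fun ε hε =>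
      reducedVelocity_eq_reducedDerivWithin I hab hγ (x := (ε, t)) ⟨hε, ht⟩))
  have h7 : bracketModel I G (reducedVelocity I a b (γ 0) t) (infinitesimalVariation I γ t) =
      bracketModel I G (reducedDerivWithin I (strip δ a b) (fun y => γ y.1 y.2) (0, t) (0, 1))
        (reducedDerivWithin I (strip δ a b) (fun y => γ y.1 y.2) (0, t) (1, 0)) :=
    congrArg₂ (bracketModel I G) h6 h5
  rw [h7, h3]

/-- The derivative of `l : G × 𝔤 → ℝ` at `(g, ξ)` along `(g η, ζ)`. -/
def trivializedDeriv (l : G → E → ℝ) (g : G) (ξ : E) : E × E →L[ℝ] ℝ :=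
  ContinuousLinearMap.comp (M₂ := E × E)
    (mfderiv (I.prod 𝓘(ℝ, E)) 𝓘(ℝ, ℝ) (fun x : G × E => l x.1 x.2) (g, ξ))
    ((leftTranslate I g).prodMap (ContinuousLinearMap.id ℝ E))

/-- This is the chain rule, with `γ'` written as `g (g⁻¹ γ')` so that only the left-trivialized
velocity enters. -/
lemma hasDerivAt_lagrangian {l : G → E → ℝ}
    (hl : ContMDiff (I.prod 𝓘(ℝ, E)) 𝓘(ℝ, ℝ) ∞ fun x : G × E => l x.1 x.2)
    {γ : ℝ → G} {ζ : ℝ → E} {ζ' : E}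
    (hγ : MDifferentiableAt 𝓘(ℝ, ℝ) I γ 0) (hζ : HasDerivAt ζ ζ' 0) :
    HasDerivAt (fun ε => l (γ ε) (ζ ε)) (trivializedDeriv I l (γ 0) (ζ 0)
      (leftTranslateInv I (γ 0) (mfderiv 𝓘(ℝ, ℝ) I γ 0 (1 : ℝ)), ζ')) 0 := by
  have h1 := ((hl (γ 0, ζ 0)).mdifferentiableAt (by simp)).hasMFDerivAt
  have h2 := HasMFDerivAt.comp (0 : ℝ) (f := fun ε => (γ ε, ζ ε)) h1
    (hγ.hasMFDerivAt.prodMk hζ.hasFDerivAt.hasMFDerivAt)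
  obtain ⟨D, hD, h3⟩ : ∃ D : ℝ →L[ℝ] ℝ, D 1 = trivializedDeriv I l (γ 0) (ζ 0)
      (leftTranslateInv I (γ 0) (mfderiv 𝓘(ℝ, ℝ) I γ 0 (1 : ℝ)), ζ') ∧
      HasFDerivAt (fun ε => l (γ ε) (ζ ε)) D 0 := by
    refine ⟨_, ?_, h2.hasFDerivAt⟩
    exact congrArg₂ (fun v w : E => (mfderiv (I.prod 𝓘(ℝ, E)) 𝓘(ℝ, ℝ)
        (fun x : G × E => l x.1 x.2) (γ 0, ζ 0) : E × E →L[ℝ] ℝ) (v, w))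
      (leftTranslate_leftTranslateInv I (γ 0) (mfderiv 𝓘(ℝ, ℝ) I γ 0 (1 : ℝ) : E)).symm
      (one_smul ℝ ζ')
  rw [← hD]
  exact h3.hasDerivAt

/-- First variation of `∫ l(g, ξ)` along a smooth family. -/
lemma hasDerivAt_integral_lagrangian (hab : a < b) (hδ : 0 < δ) {l : G → E → ℝ}
    (hl : ContMDiff (I.prod 𝓘(ℝ, E)) 𝓘(ℝ, ℝ) ∞ fun x : G × E => l x.1 x.2)
    {γ : ℝ → ℝ → G} {ζ : ℝ → ℝ → E} {g : ℝ → G} {ξ η ζ' : ℝ → E}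
    (hγ : SmoothFamily I δ a b γ)
    (hζ : ContDiffOn ℝ ∞ (fun x : ℝ × ℝ => ζ x.1 x.2) (strip δ a b))
    (hg : ∀ t ∈ Icc a b, γ 0 t = g t) (hξ : ∀ t ∈ Icc a b, ζ 0 t = ξ t)
    (hη : ∀ t ∈ Icc a b, infinitesimalVariation I γ t = η t)
    (hζ' : ∀ t ∈ Icc a b, HasDerivAt (fun ε => ζ ε t) (ζ' t) 0) :
    HasDerivAt (fun ε => ∫ t in a..b, l (γ ε t) (ζ ε t))
      (∫ t in a..b, trivializedDeriv I l (g t) (ξ t) (η t, ζ' t)) 0 := by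
  refine hasDerivAt_integral_strip hab hδ (contDiffOn_lagrangian I hl hγ hζ) fun t ht => ?_
  have h1 := hasDerivAt_lagrangian I hl (mdifferentiableAt_param I hγ (mem_strip_zero hδ ht))
    (hζ' t ht)
  rw [← hg t ht, ← hξ t ht, ← hη t ht]
  exact h1

/-- First variation of the trivialized Hamilton-Pontryagin action along a smooth family. -/
lemma hasDerivAt_trivializedHPAction (hab : a < b) (hδ : 0 < δ) {l : G → E → ℝ}
    (hl : ContMDiff (I.prod 𝓘(ℝ, E)) 𝓘(ℝ, ℝ) ∞ fun x : G × E => l x.1 x.2)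
    {γ : ℝ → ℝ → G} {ζ : ℝ → ℝ → E} {ν : ℝ → ℝ → E →L[ℝ] ℝ} {g : ℝ → G} {ξ η θ ζ' θ' : ℝ → E}
    {μ ν' : ℝ → E →L[ℝ] ℝ}
    (hγ : SmoothFamily I δ a b γ)
    (hζ : ContDiffOn ℝ ∞ (fun x : ℝ × ℝ => ζ x.1 x.2) (strip δ a b))
    (hν : ContDiffOn ℝ ∞ (fun x : ℝ × ℝ => ν x.1 x.2) (strip δ a b))
    (hg : ∀ t ∈ Icc a b, γ 0 t = g t) (hξ : ∀ t ∈ Icc a b, ζ 0 t = ξ t)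
    (hμ : ∀ t ∈ Icc a b, ν 0 t = μ t)
    (hθ : ∀ t ∈ Icc a b, reducedVelocity I a b g t = θ t)
    (hη : ∀ t ∈ Icc a b, infinitesimalVariation I γ t = η t)
    (hζ' : ∀ t ∈ Icc a b, HasDerivAt (fun ε => ζ ε t) (ζ' t) 0)
    (hθ' : ∀ t ∈ Icc a b, HasDerivAt (F := E) (fun ε => reducedVelocity I a b (γ ε) t) (θ' t) 0)
    (hν' : ∀ t ∈ Icc a b, HasDerivAt (fun ε => ν ε t) (ν' t) 0) :
    HasDerivAt (fun ε => trivializedHPAction I l a b (fun t => (γ ε t, ζ ε t, ν ε t)))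
      (∫ t in a..b, (trivializedDeriv I l (g t) (ξ t) (η t, ζ' t) +
        (ν' t (θ t - ξ t) + μ t (θ' t - ζ' t)))) 0 := by
  have h2 := contDiffOn_reducedVelocity_family I hab hγ
  refine hasDerivAt_integral_strip hab hδ
    (h := fun ε t => l (γ ε t) (ζ ε t) +
      ν ε t (Sub.sub (α := E) (reducedVelocity I a b (γ ε) t) (ζ ε t)))
    ((contDiffOn_lagrangian I hl hγ hζ).add
      (hν.clm_apply (ContDiffOn.sub (F := E) h2 hζ))) fun t ht => ?_
  have h1 := hasDerivAt_lagrangian I hl (mdifferentiableAt_param I hγ (mem_strip_zero hδ ht))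
    (hζ' t ht)
  have h3 := h1.add ((hν' t ht).clm_apply (HasDerivAt.sub (F := E) (hθ' t ht) (hζ' t ht)))
  rw [← hg t ht, ← hξ t ht, ← hη t ht, ← hμ t ht, ← hθ t ht, ← reducedVelocity_congr I hg ht]
  exact h3

end FamiliesOfCurves

/-! ### Variations, trivialized actions and stationarity in `ξ` and `μ` -/

section Principles

open scoped Topology

variable {E : Type*} [NormedAddCommGroup E] [NormedSpace ℝ E]
  {H : Type*} [TopologicalSpace H] (I : ModelWithCorners ℝ E H)
  {G : Type*} [TopologicalSpace G] [ChartedSpace H G] [Group G] [LieGroup I ∞ G]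
  {a b : ℝ}

/-- Every infinitesimal variation vanishing at the endpoints comes from a variation with fixed
endpoints. -/
lemma exists_variation_fixed_endpoints [I.Boundaryless] {g : ℝ → G}
    (hg : ContMDiffOn 𝓘(ℝ, ℝ) I ∞ g (Icc a b)) {η : ℝ → E} (hη : ContDiffOn ℝ ∞ η (Icc a b))
    (ha : η a = 0) (hb : η b = 0) :
    ∃ δ > 0, ∃ γ : ℝ → ℝ → G, SmoothFamily I δ a b γ ∧ (∀ t, γ 0 t = g t) ∧
      (∀ ε, γ ε a = g a ∧ γ ε b = g b) ∧
      ∀ t ∈ Icc a b, (infinitesimalVariation I γ t : E) = η t := by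
  set φ := extChartAt I (1 : G) with hφ
  obtain ⟨r, hr, hball⟩ := Metric.mem_nhds_iff.1 (extChartAt_target_mem_nhds (I := I) (1 : G))
  obtain ⟨C, hC⟩ := isCompact_Icc.exists_bound_of_continuousOn hη.continuousOn
  have hC0 : 0 < |C| + 1 := by positivity
  -- `|C| + 1` is positive and strictly bounds `‖η‖` on `[a, b]`, so `ε η(t)` has norm below `r` and
  -- stays in the chart.
  set δ := r / (|C| + 1) with hδ
  have hδ0 : 0 < δ := div_pos hr hC0
  have htarget : ∀ x ∈ strip δ a b, φ 1 + x.1 • η x.2 ∈ φ.target := by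
    intro x hx
    apply hball
    rw [mem_ball_iff_norm, add_sub_cancel_left, norm_smul, Real.norm_eq_abs]
    have h1 : |x.1| < δ := abs_lt.2 hx.1
    have h2 : ‖η x.2‖ < |C| + 1 := ((hC x.2 hx.2).trans (le_abs_self C)).trans_lt (lt_add_one _)
    calc |x.1| * ‖η x.2‖ ≤ |x.1| * (|C| + 1) := by gcongr
      _ < δ * (|C| + 1) := by gcongr
      _ = r := div_mul_cancel₀ r hC0.ne'
  have h1 : φ.symm (φ 1) = 1 := extChartAt_to_inv (1 : G)
  -- The inverse chart at `1` plays the role of the exponential map: its derivative at the centre is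
  -- the identity, so `g⁻¹ δg = η`.
  refine ⟨δ, hδ0, fun ε t => g t * φ.symm (φ 1 + ε • η t), ?_, fun t => ?_, fun ε => ?_,
    fun t ht => ?_⟩
  · have h2 : ContMDiffOn 𝓘(ℝ, ℝ × ℝ) 𝓘(ℝ, E) ∞ (fun x : ℝ × ℝ => φ 1 + x.1 • η x.2)
        (strip δ a b) :=
      (contDiffOn_const.add (contDiffOn_fst.smul
        (hη.comp contDiffOn_snd fun x hx => hx.2))).contMDiffOn
    exact ContMDiffOn.mul (I' := 𝓘(ℝ, ℝ × ℝ)) (I := I) (smoothFamily_const I hg)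
      ((contMDiffOn_extChartAt_symm (1 : G)).comp h2 htarget)
  · simp [h1]
  · simp [ha, hb, h1]
  · have h2 : HasFDerivAt (fun ε : ℝ => φ 1 + ε • η t)
        ((ContinuousLinearMap.id ℝ ℝ).smulRight (η t)) 0 :=
      ((hasFDerivAt_id (0 : ℝ)).smul_const (η t)).const_add (φ 1)
    have h3 : φ 1 + (0 : ℝ) • η t = φ 1 := by simp
    have h4 : HasMFDerivAt 𝓘(ℝ, E) I φ.symm (φ 1 + (0 : ℝ) • η t)
        (ContinuousLinearMap.id ℝ E : E →L[ℝ] E) := by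
      have hd : MDifferentiableAt 𝓘(ℝ, E) I φ.symm (φ 1) :=
        ((contMDiffOn_extChartAt_symm (n := ∞) (1 : G)).contMDiffAt
          (extChartAt_target_mem_nhds (1 : G))).mdifferentiableAt (by simp)
      have h := mfderivWithin_range_extChartAt_symm (I := I) (x := (1 : G))
      rw [I.range_eq_univ, mfderivWithin_univ] at h
      have h' := hd.hasMFDerivAt
      rw [h] at h'
      rw [h3]
      exact h'
    have h5 : HasMFDerivAt I I (fun x => g t * x) (φ.symm (φ 1 + (0 : ℝ) • η t))
        (leftTranslate I (g t) : E →L[ℝ] E) := by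
      rw [h3, h1]
      exact (mdifferentiableAt_mul_left I (g t) 1).hasMFDerivAt
    have h6 := (h5.comp (0 : ℝ) (h4.comp (0 : ℝ) h2.hasMFDerivAt)).mfderiv
    have h7 : (fun ε : ℝ => g t * φ.symm (φ 1 + ε • η t)) 0 = g t := by simp [h1]
    have h8 : (leftTranslateInv I ((fun ε : ℝ => g t * φ.symm (φ 1 + ε • η t)) 0) : E →L[ℝ] E) =
      leftTranslateInv I (g t) := by rw [h7]
    refine Eq.trans (congrArg₂ (fun (A : E →L[ℝ] E) (D : ℝ →L[ℝ] E) => A (D 1)) h8 h6) ?_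
    refine Eq.trans ?_ (leftTranslateInv_leftTranslate I (g t) (η t))
    exact congrArg (fun v : E => leftTranslateInv I (g t) (leftTranslate I (g t) v))
      (one_smul ℝ (η t))

lemma contMDiff_trivializedLagrangian {L : TangentBundle I G → ℝ}
    (hL : ContMDiff I.tangent 𝓘(ℝ, ℝ) ∞ L) :
    ContMDiff (I.prod 𝓘(ℝ, E)) 𝓘(ℝ, ℝ) ∞ fun x : G × E => trivializedLagrangian I L x.1 x.2 :=
  hL.comp (contMDiff_leftTranslateBundle I)

lemma action_eq (L : TangentBundle I G → ℝ) (g : ℝ → G) :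
    action I L a b g = ∫ t in a..b, trivializedLagrangian I L (g t) (reducedVelocity I a b g t) :=
  intervalIntegral.integral_congr fun t _ => congrArg L (tangentBundle_ext I rfl
    (leftTranslate_leftTranslateInv I (g t) (velocity I a b g t : E)).symm)

/-- The integrands agree pointwise, since `⟨g⁻¹ p, g⁻¹ v⟩ = ⟨p, v⟩`. -/
lemma hpAction_eq (L : TangentBundle I G → ℝ) (c : ℝ → PontryaginBundle I G) :
    hpAction I L a b c =
      trivializedHPAction I (trivializedLagrangian I L) a b fun t => leftTrivialization I (c t) := by
  refine intervalIntegral.integral_congr fun t _ => ?_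
  refine congrArg₂ (· + ·) (congrArg L (tangentBundle_ext I rfl
    (leftTranslate_leftTranslateInv I (c t).proj ((c t).2.1 : E)).symm)) ?_
  set v : E := velocity I a b (fun s => (c s).proj) t with hv
  set w : E := (c t).2.1 with hw
  set p : E →L[ℝ] ℝ := (c t).2.2 with hp
  change p (v - w) = p (leftTranslate I (c t).proj
    (leftTranslateInv I (c t).proj v - leftTranslateInv I (c t).proj w))
  rw [← map_sub, leftTranslate_leftTranslateInv]

lemma leftTrivializationSymm_leftTrivialization (x : PontryaginBundle I G) :
    leftTrivializationSymm I (leftTrivialization I x) = x := by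
  obtain ⟨g, v, p⟩ := x
  have h1 : leftTranslate I g (leftTranslateInv I g (v : E)) = v :=
    leftTranslate_leftTranslateInv I g v
  have h2 : ContinuousLinearMap.comp (M₁ := E) (M₂ := E)
      (ContinuousLinearMap.comp (M₁ := E) (M₂ := E) p (leftTranslate (E := E) I g))
      (leftTranslateInv (E := E) I g) = (p : E →L[ℝ] ℝ) :=
    ContinuousLinearMap.ext fun w => congrArg p (leftTranslate_leftTranslateInv I g w)
  exact congrArg₂ (fun (v : E) (p : E →L[ℝ] ℝ) => (⟨g, (v, p)⟩ : PontryaginBundle I G)) h1 h2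

/-- The Hamilton-Pontryagin principle is equivalent to its left trivialization. -/
lemma hpPrinciple_iff_trivializedHPPrinciple [FiniteDimensional ℝ E] (L : TangentBundle I G → ℝ)
    (c : ℝ → PontryaginBundle I G) :
    HPPrinciple I L a b c ↔ TrivializedHPPrinciple I (trivializedLagrangian I L) a b
      fun t => leftTrivialization I (c t) := by
  constructor
  · intro h δ γ hδ h1 h2 h3 h0 hend
    have := h δ (fun ε t => leftTrivializationSymm I (γ ε t)) hδ
      (contMDiffOn_leftTrivializationSymm I h1 h2 h3)
      (fun t ht => by rw [h0 t ht, leftTrivializationSymm_leftTrivialization]) hend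
    simpa only [hpAction_eq, leftTrivialization_symm] using this
  · intro h δ γ hδ h1 h0 hend
    obtain ⟨h2, h3, h4⟩ := contMDiffOn_leftTrivialization I h1
    have := h δ (fun ε t => leftTrivialization I (γ ε t)) hδ h2 h3 h4
      (fun t ht => by rw [h0 t ht]) hend
    simpa only [hpAction_eq] using this

section Trivialized

variable {l : G → E → ℝ}

/-- The fibre derivative of `l` along a smooth curve is smooth. -/
lemma contDiffOn_trivializedDeriv_fiber [FiniteDimensional ℝ E] (hab : a < b)
    (hl : ContMDiff (I.prod 𝓘(ℝ, E)) 𝓘(ℝ, ℝ) ∞ fun x : G × E => l x.1 x.2)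
    {g : ℝ → G} {ξ : ℝ → E} (hg : ContMDiffOn 𝓘(ℝ, ℝ) I ∞ g (Icc a b))
    (hξ : ContDiffOn ℝ ∞ ξ (Icc a b)) :
    ContDiffOn ℝ ∞ (fun t => (trivializedDeriv I l (g t) (ξ t)).comp
      (ContinuousLinearMap.inr ℝ E E)) (Icc a b) := by
  refine contDiffOn_clm_apply.2 fun w => ?_
  -- The fibre derivative along `w` is the `ε`-derivative at `0` of `l(g, ξ + ε w)`, a smooth
  -- function on a strip; the width `1` is arbitrary.
  have h1 : ContDiffOn ℝ ∞ (fun x : ℝ × ℝ => ξ x.2 + x.1 • w) (strip 1 a b) :=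
    (hξ.comp contDiffOn_snd fun x hx => hx.2).add (contDiffOn_fst.smul contDiffOn_const)
  have h2 := contDiffOn_lagrangian I (δ := 1) hl (smoothFamily_const I hg)
    (ζ := fun ε t => ξ t + ε • w) h1
  refine (contDiffOn_deriv_param hab one_pos h2).congr fun t ht => ?_
  have h3 : HasDerivAt (fun ε : ℝ => ξ t + ε • w) w 0 := by
    simpa using ((hasDerivAt_id (0 : ℝ)).smul_const w).const_add (ξ t)
  have h4 := hasDerivAt_lagrangian I hl (γ := fun _ => g t) mdifferentiableAt_const h3
  rw [h4.deriv]
  have h5 := infinitesimalVariation_const I g t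
  refine (congrArg₂ (fun u v : E => trivializedDeriv I l (g t) u (v, w)) ?_ h5).symm
  simp

/-- Solutions of the trivialized Hamilton-Pontryagin principle satisfy `ξ = g⁻¹ ġ` and
`μ = ∂l/∂ξ`. -/
lemma TrivializedHPPrinciple.eq_reducedVelocity_and_eq_deriv [FiniteDimensional ℝ E] (hab : a < b)
    (hl : ContMDiff (I.prod 𝓘(ℝ, E)) 𝓘(ℝ, ℝ) ∞ fun x : G × E => l x.1 x.2)
    {g : ℝ → G} {ξ : ℝ → E} {μ : ℝ → E →L[ℝ] ℝ} (hg : ContMDiffOn 𝓘(ℝ, ℝ) I ∞ g (Icc a b))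
    (hξ : ContDiffOn ℝ ∞ ξ (Icc a b)) (hμ : ContDiffOn ℝ ∞ μ (Icc a b))
    (h : TrivializedHPPrinciple I l a b fun t => (g t, ξ t, μ t)) :
    (∀ t ∈ Icc a b, ξ t = reducedVelocity I a b g t) ∧
      ∀ t ∈ Icc a b, ∀ w : E, trivializedDeriv I l (g t) (ξ t) (0, w) = μ t w := by
  obtain ⟨θ, hθ⟩ : ∃ θ : ℝ → E, θ = reducedVelocity I a b g := ⟨_, rfl⟩
  have hθs : ContDiffOn ℝ ∞ θ (Icc a b) := by
    rw [hθ]; exact contDiffOn_reducedVelocity I hab hg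
  have hγ : SmoothFamily I 1 a b fun _ => g := smoothFamily_const I hg
  have hlift : ∀ {F : Type _} [NormedAddCommGroup F] [NormedSpace ℝ F] {f f' : ℝ → F},
      ContDiffOn ℝ ∞ f (Icc a b) → ContDiffOn ℝ ∞ f' (Icc a b) →
      ContDiffOn ℝ ∞ (fun x : ℝ × ℝ => f x.2 + x.1 • f' x.2) (strip 1 a b) :=
    fun hf hf' => (hf.comp contDiffOn_snd fun x hx => hx.2).add
      (contDiffOn_fst.smul (hf'.comp contDiffOn_snd fun x hx => hx.2))
  have hder : ∀ {F : Type _} [NormedAddCommGroup F] [NormedSpace ℝ F] (u v : F),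
      HasDerivAt (fun ε : ℝ => u + ε • v) v 0 := fun u v => by
    simpa using ((hasDerivAt_id (0 : ℝ)).smul_const v).const_add u
  -- The test family is `(g, ξ + ε ζ', μ + ε ν')`. As `g` does not move, `ζ'` and `ν'` are free even
  -- at the endpoints.
  have key : ∀ {ζ' : ℝ → E} {ν' : ℝ → E →L[ℝ] ℝ}, ContDiffOn ℝ ∞ ζ' (Icc a b) →
      ContDiffOn ℝ ∞ ν' (Icc a b) →
      ∫ t in a..b, (trivializedDeriv I l (g t) (ξ t) (0, ζ' t) +
        (ν' t (θ t - ξ t) + μ t (0 - ζ' t))) = 0 := by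
    intro ζ' ν' hζ' hν'
    have h1 := hasDerivAt_trivializedHPAction I hab one_pos hl (g := g) (ξ := ξ) (μ := μ)
      (η := fun _ => 0) (θ := θ) (θ' := fun _ => 0) hγ (hlift hξ hζ') (hlift hμ hν')
      (fun _ _ => rfl) (fun t _ => by simp) (fun t _ => by simp) (fun t _ => by rw [hθ])
      (fun t _ => infinitesimalVariation_const I g t)
      (fun t _ => hder _ _) (fun t _ => hasDerivAt_const (F := E) _ _) (fun t _ => hder _ _)
    exact h1.unique (h 1 _ one_pos hγ (hlift hξ hζ') (hlift hμ hν')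
      (fun t _ => by simp) fun _ _ => ⟨rfl, rfl⟩)
  have hvel : ∀ t ∈ Icc a b, θ t - ξ t = 0 := by
    intro t ht
    refine SeparatingDual.eq_zero_of_forall_dual_eq_zero (R := ℝ) fun p => ?_
    have hs : ContDiffOn ℝ ∞ (fun t => p (θ t - ξ t)) (Icc a b) :=
      p.contDiff.comp_contDiffOn (hθs.sub hξ)
    -- This `ν'` turns the integrand into the square of `p (θ - ξ)`.
    have h1 := key (ζ' := fun _ => 0) (ν' := fun t => p (θ t - ξ t) • p) contDiffOn_const
      (hs.smul contDiffOn_const)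
    exact eq_zero_of_integral_mul_self_eq_zero hab hs.continuousOn
      (by simpa [← Prod.zero_eq_mk] using h1) t ht
  refine ⟨fun t ht => ?_, fun t ht w => ?_⟩
  · rw [← hθ]; exact (sub_eq_zero.1 (hvel t ht)).symm
  · have hs : ContDiffOn ℝ ∞ (fun t => trivializedDeriv I l (g t) (ξ t) (0, w) - μ t w)
        (Icc a b) :=
      ((contDiffOn_trivializedDeriv_fiber I hab hl hg hξ).clm_apply contDiffOn_const).sub
        (hμ.clm_apply contDiffOn_const)
    -- Taking `ζ'` to be the residual `∂l/∂ξ(w) - μ(w)` times `w` makes the integrand the square of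
    -- the residual.
    have h1 := key (ν' := fun _ => 0) (hs.smul (contDiffOn_const (c := w))) contDiffOn_const
    refine sub_eq_zero.1 (eq_zero_of_integral_mul_self_eq_zero hab hs.continuousOn ?_ t ht)
    rw [← h1]
    refine intervalIntegral.integral_congr fun t _ => ?_
    have h2 : ∀ r : ℝ, trivializedDeriv I l (g t) (ξ t) (0, r • w) =
        r * trivializedDeriv I l (g t) (ξ t) (0, w) := fun r => by
      rw [← smul_eq_mul, ← map_smul, Prod.smul_mk, smul_zero]
    simp only [Pi.smul_apply', h2]
    simp
    ring

end Trivialized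

end Principles

/-! ### Implications between the principles -/

section Equivalences

open scoped Topology

variable {E : Type*} [NormedAddCommGroup E] [NormedSpace ℝ E]
  {H : Type*} [TopologicalSpace H] (I : ModelWithCorners ℝ E H)
  {G : Type*} [TopologicalSpace G] [ChartedSpace H G] [Group G] [LieGroup I ∞ G]
  {a b : ℝ} {L : TangentBundle I G → ℝ} {g : ℝ → G}

/-- Hamilton's principle in Euler-Poincaré form. -/
lemma HamiltonPrinciple.integral_eq_zero [CompleteSpace E] [I.Boundaryless] (hab : a < b)
    (hL : ContMDiff I.tangent 𝓘(ℝ, ℝ) ∞ L) (hg : ContMDiffOn 𝓘(ℝ, ℝ) I ∞ g (Icc a b))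
    (h : HamiltonPrinciple I L a b g) {η : ℝ → E} (hη : ContDiffOn ℝ ∞ η (Icc a b))
    (ha : η a = 0) (hb : η b = 0) :
    ∫ t in a..b, trivializedDeriv (E := E) I (trivializedLagrangian I L) (g t)
      (reducedVelocity I a b g t) (η t, derivWithin η (Icc a b) t +
        bracketModel I G (reducedVelocity I a b g t) (η t)) = 0 := by
  obtain ⟨δ, hδ, γ, hγ, h0, hend, hvar⟩ := exists_variation_fixed_endpoints I hg hη ha hb
  have h1 := h δ γ hδ hγ (fun t _ => h0 t) fun ε _ => hend ε
  simp only [action_eq] at h1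
  refine (hasDerivAt_integral_lagrangian (E := E) I hab hδ (contMDiff_trivializedLagrangian I hL)
    hγ (contDiffOn_reducedVelocity_family I hab hγ) (fun t _ => h0 t)
    (fun t ht => reducedVelocity_congr I (fun t _ => h0 t) ht) hvar fun t ht => ?_).unique h1
  have h2 := hasDerivAt_reducedVelocity I hab hδ hγ ht
  have h3 : derivWithin (F := E) (infinitesimalVariation I γ) (Icc a b) t =
      derivWithin η (Icc a b) t := derivWithin_congr (F := E) hvar (hvar t ht)
  have h4 : bracketModel I G (reducedVelocity I a b (γ 0) t) (infinitesimalVariation I γ t) =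
      bracketModel I G (reducedVelocity I a b g t) (η t) :=
    congrArg₂ (bracketModel I G) (reducedVelocity_congr I (fun t _ => h0 t) ht) (hvar t ht)
  rw [h3, h4] at h2
  exact h2

/-- An admissible `(γ, ζ)` need not fix the endpoints for `ε ≠ 0`, nor satisfy `ζ = γ⁻¹ γ̇`. Its
first variation still depends only on `η`, and is the integral that vanishes by
`HamiltonPrinciple.integral_eq_zero`. -/
lemma HamiltonPrinciple.reducedPrinciple [CompleteSpace E] [I.Boundaryless] (hab : a < b)
    (hL : ContMDiff I.tangent 𝓘(ℝ, ℝ) ∞ L) (hg : ContMDiffOn 𝓘(ℝ, ℝ) I ∞ g (Icc a b))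
    (h : HamiltonPrinciple I L a b g) : ReducedPrinciple I (trivializedLagrangian I L) a b g := by
  intro δ γ ζ η hδ hγ hζ h0 hη hζ' ha hb
  have hηs : ContDiffOn ℝ ∞ (F := E) η (Icc a b) :=
    ContDiffOn.congr (F := E) (contDiffOn_infinitesimalVariation I hab hδ hγ) hη
  have h1 := h.integral_eq_zero I hab hL hg hηs ha hb
  have h2 := hasDerivAt_integral_lagrangian (E := E) I hab hδ
    (contMDiff_trivializedLagrangian I hL) hγ hζ (fun t ht => (h0 t ht).1)
    (fun t ht => (h0 t ht).2) (fun t ht => (hη t ht).symm) hζ'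
  exact Eq.mp (congrArg (fun r => HasDerivAt _ r 0) h1) h2

/-- Pairing `γ` with its own reduced velocities gives an admissible variation, by
`hasDerivAt_reducedVelocity`. -/
lemma ReducedPrinciple.hamiltonPrinciple [CompleteSpace E] [I.Boundaryless] (hab : a < b)
    (h : ReducedPrinciple I (trivializedLagrangian I L) a b g) : HamiltonPrinciple I L a b g := by
  intro δ γ hδ hγ h0 hend
  simp only [action_eq]
  refine h δ γ (fun ε => reducedVelocity I a b (γ ε)) (infinitesimalVariation I γ) hδ hγ
    (contDiffOn_reducedVelocity_family I hab hγ)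
    (fun t ht => ⟨h0 t ht, reducedVelocity_congr I h0 ht⟩) (fun _ _ => rfl) (fun t ht => ?_)
    (infinitesimalVariation_eq_zero I hδ fun ε hε => (hend ε hε).1)
    (infinitesimalVariation_eq_zero I hδ fun ε hε => (hend ε hε).2)
  have h1 := hasDerivAt_reducedVelocity I hab hδ hγ ht
  have h2 : bracketModel I G (reducedVelocity I a b (γ 0) t) (infinitesimalVariation I γ t) =
      bracketModel I G (reducedVelocity I a b g t) (infinitesimalVariation I γ t) :=
    congrArg₂ (bracketModel I G) (reducedVelocity_congr I h0 ht) rfl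
  rw [h2] at h1
  exact h1

lemma HamiltonPrinciple.exists_trivializedHPPrinciple [FiniteDimensional ℝ E] [I.Boundaryless]
    (hab : a < b) (hL : ContMDiff I.tangent 𝓘(ℝ, ℝ) ∞ L)
    (hg : ContMDiffOn 𝓘(ℝ, ℝ) I ∞ g (Icc a b)) (h : HamiltonPrinciple I L a b g) :
    ∃ c : ℝ → G × GroupLieAlgebra I G × (GroupLieAlgebra I G →L[ℝ] ℝ),
      SmoothTrivializedPath I a b c ∧ (∀ t ∈ Icc a b, (c t).1 = g t) ∧
      TrivializedHPPrinciple I (trivializedLagrangian I L) a b c := by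
  have : CompleteSpace E := FiniteDimensional.complete ℝ E
  have hl := contMDiff_trivializedLagrangian I hL
  obtain ⟨θ, hθ⟩ : ∃ θ : ℝ → E, θ = reducedVelocity I a b g := ⟨_, rfl⟩
  have hθs : ContDiffOn ℝ ∞ θ (Icc a b) := by
    rw [hθ]; exact contDiffOn_reducedVelocity I hab hg
  -- The momentum is the Legendre transform `∂l/∂ξ` at `ξ = g⁻¹ ġ`.
  obtain ⟨μ, hμ⟩ : ∃ μ : ℝ → E →L[ℝ] ℝ, μ = fun t =>
    (trivializedDeriv (E := E) I (trivializedLagrangian I L) (g t) (θ t)).comp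
      (ContinuousLinearMap.inr ℝ E E) := ⟨_, rfl⟩
  refine ⟨fun t => (g t, θ t, μ t), ⟨hg, hθs, ?_⟩, fun _ _ => rfl, ?_⟩
  · rw [hμ]
    exact contDiffOn_trivializedDeriv_fiber I hab hl hg hθs
  · intro δ γ hδ hγ hζ hν h0 hend
    have hg0 : ∀ t ∈ Icc a b, (γ 0 t).1 = g t := fun t ht => congrArg Prod.fst (h0 t ht)
    obtain ⟨η, hη⟩ : ∃ η : ℝ → E, η = infinitesimalVariation I fun ε t => (γ ε t).1 := ⟨_, rfl⟩
    have hηs : ContDiffOn ℝ ∞ η (Icc a b) := by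
      rw [hη]; exact contDiffOn_infinitesimalVariation I hab hδ hγ
    have hweak := h.integral_eq_zero I hab hL hg hηs
      (by rw [hη]; exact infinitesimalVariation_eq_zero I hδ fun ε hε => (hend ε hε).1)
      (by rw [hη]; exact infinitesimalVariation_eq_zero I hδ fun ε hε => (hend ε hε).2)
    have hθ' : ∀ t ∈ Icc a b, HasDerivAt (F := E)
        (fun ε => reducedVelocity I a b (fun s => (γ ε s).1) t)
        (derivWithin η (Icc a b) t + bracketModel I G (θ t) (η t)) 0 := fun t ht => by
      have h2 := hasDerivAt_reducedVelocity I hab hδ hγ ht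
      have h3 : bracketModel I G (reducedVelocity I a b (fun t => (γ 0 t).1) t)
          (infinitesimalVariation I (fun ε t => (γ ε t).1) t) = bracketModel I G (θ t) (η t) :=
        congrArg₂ (bracketModel I G) ((reducedVelocity_congr I hg0 ht).trans (by rw [hθ]))
          (by rw [hη])
      rw [h3] at h2
      rw [hη] at h2 ⊢
      exact h2
    have hder : ∀ {F : Type _} [NormedAddCommGroup F] [NormedSpace ℝ F] {f : ℝ → ℝ → F},
        ContDiffOn ℝ ∞ (fun x : ℝ × ℝ => f x.1 x.2) (strip δ a b) → ∀ t ∈ Icc a b,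
        HasDerivAt (fun ε => f ε t) (deriv (fun ε => f ε t) 0) 0 := fun hf t ht =>
      (hasDerivAt_param_of_differentiableWithinAt
        (hf.differentiableOn (by simp) _ (mem_strip_zero hδ ht))
        (mem_strip_zero hδ ht)).differentiableAt.hasDerivAt
    have h1 := hasDerivAt_trivializedHPAction (E := E) I hab hδ hl (g := g) (ξ := θ) (η := η)
      (θ := θ) (μ := μ) (γ := fun ε t => (γ ε t).1) (ζ := fun ε t => (γ ε t).2.1)
      (ν := fun ε t => (γ ε t).2.2) hγ hζ hν hg0
      (fun t ht => congrArg (fun x => x.2.1) (h0 t ht))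
      (fun t ht => congrArg (fun x => x.2.2) (h0 t ht)) (fun t _ => by rw [hθ])
      (fun t _ => by rw [hη]) (hder (F := E) hζ) hθ' (hder (F := E →L[ℝ] ℝ) hν)
    refine Eq.mp (congrArg (fun r => HasDerivAt _ r 0) ?_) h1
    -- `δμ` is paired with `θ - θ = 0`, and `dl(η, δξ) + dl(0, θ' - δξ) = dl(η, θ')`, where `θ' = η̇
    -- + [θ, η]`.
    refine Eq.trans (intervalIntegral.integral_congr fun t _ => ?_) hweak
    have h4 : (reducedVelocity I a b g t : E) = θ t := by rw [hθ]
    rw [h4]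
    simp only [hμ, sub_self, map_zero, zero_add, ContinuousLinearMap.comp_apply,
      ContinuousLinearMap.inr_apply]
    rw [← map_add, Prod.mk_add_mk, add_zero, add_sub_cancel]

lemma TrivializedHPPrinciple.hamiltonPrinciple [FiniteDimensional ℝ E] (hab : a < b)
    (hL : ContMDiff I.tangent 𝓘(ℝ, ℝ) ∞ L)
    {c : ℝ → G × GroupLieAlgebra I G × (GroupLieAlgebra I G →L[ℝ] ℝ)}
    (hc : SmoothTrivializedPath I a b c) (hcg : ∀ t ∈ Icc a b, (c t).1 = g t)
    (h : TrivializedHPPrinciple I (trivializedLagrangian I L) a b c) :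
    HamiltonPrinciple I L a b g := by
  have hξ := (TrivializedHPPrinciple.eq_reducedVelocity_and_eq_deriv (E := E) I hab
    (contMDiff_trivializedLagrangian I hL) hc.1 hc.2.1 hc.2.2 h).1
  intro δ γ hδ hγ h0 hend
  have hμ : ContDiffOn ℝ ∞ (F := E →L[ℝ] ℝ) (fun x : ℝ × ℝ => (c x.2).2.2) (strip δ a b) :=
    ContDiffOn.comp (F := ℝ) (G := E →L[ℝ] ℝ) hc.2.2 contDiffOn_snd fun x hx => hx.2
  -- With `ξ` tied to `γ` and `μ` frozen, the constraint term is identically zero. The family starts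
  -- at `c` because `hξ` identifies `ξ` with `g⁻¹ ġ`.
  have h1 := h δ (fun ε t => (γ ε t, reducedVelocity I a b (γ ε) t, (c t).2.2)) hδ hγ
    (contDiffOn_reducedVelocity_family I hab hγ) hμ
    (fun t ht => Prod.ext ((h0 t ht).trans (hcg t ht).symm) (Prod.ext
      ((reducedVelocity_congr I (fun s hs => (h0 s hs).trans (hcg s hs).symm) ht).trans
        (hξ t ht).symm) rfl))
    (fun ε hε => ⟨(hend ε hε).1.trans (hcg a ⟨le_rfl, hab.le⟩).symm,
      (hend ε hε).2.trans (hcg b ⟨hab.le, le_rfl⟩).symm⟩)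
  refine Eq.mp (congrArg (fun f => HasDerivAt f 0 0) (funext fun ε => ?_)) h1
  rw [action_eq]
  refine intervalIntegral.integral_congr fun t _ => ?_
  simp only [sub_self, map_zero, add_zero]

/-- The fibre derivative of `L` in terms of its left trivialization. -/
lemma hasDerivAt_fiber (hL : ContMDiff I.tangent 𝓘(ℝ, ℝ) ∞ L) (x : G) (v w : E) :
    HasDerivAt (fun s : ℝ => L (⟨x, v + s • w⟩ : TangentBundle I G))
      (trivializedDeriv (E := E) I (trivializedLagrangian I L) x (leftTranslateInv I x v)
        (0, leftTranslateInv I x w)) 0 := by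
  have h1 : HasDerivAt (fun s : ℝ => leftTranslateInv I x v + s • leftTranslateInv I x w)
      (leftTranslateInv I x w) 0 := by
    simpa using ((hasDerivAt_id (0 : ℝ)).smul_const (leftTranslateInv I x w)).const_add
      (leftTranslateInv I x v)
  have h2 := hasDerivAt_lagrangian (E := E) I (contMDiff_trivializedLagrangian I hL)
    (γ := fun _ => x) mdifferentiableAt_const h1
  have h3 : (leftTranslateInv I x v + (0 : ℝ) • leftTranslateInv I x w : E) =
      leftTranslateInv I x v := by simp
  have h4 : (leftTranslateInv I x (mfderiv 𝓘(ℝ, ℝ) I (fun _ : ℝ => x) 0 (1 : ℝ)) : E) = 0 :=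
    infinitesimalVariation_const I (fun _ => x) 0
  refine Eq.mp (congrArg₂ (fun f r => HasDerivAt f r 0) (funext fun s => ?_) ?_) h2
  · refine congrArg L (tangentBundle_ext I rfl ?_)
    rw [← map_smul, ← map_add]
    exact leftTranslate_leftTranslateInv I x (v + s • w)
  · exact congrArg₂ (fun u u' : E => trivializedDeriv (E := E) I (trivializedLagrangian I L) x u
      (u', leftTranslateInv I x w)) h3 h4

end Equivalences

end HamiltonPontryagin

end

/-! ### The main theorem -/

theorem mainTheorem1
    {E : Type*} [NormedAddCommGroup E] [NormedSpace ℝ E] [FiniteDimensional ℝ E]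
    {H : Type*} [TopologicalSpace H] (I : ModelWithCorners ℝ E H) [I.Boundaryless]
    {G : Type*} [TopologicalSpace G] [ChartedSpace H G] [Group G] [LieGroup I ∞ G]
    (L : TangentBundle I G → ℝ) (hL : ContMDiff I.tangent 𝓘(ℝ, ℝ) ∞ L)
    (a b : ℝ) (hab : a < b) :
    -- the four principles are equivalent for every smooth curve `g : [a, b] → G`
    (∀ g : ℝ → G, ContMDiffOn 𝓘(ℝ, ℝ) I ∞ g (Icc a b) →
      List.TFAE [
        HamiltonPontryagin.HamiltonPrinciple I L a b g,
        HamiltonPontryagin.ReducedPrinciple I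
          (HamiltonPontryagin.trivializedLagrangian I L) a b g,
        ∃ c : ℝ → HamiltonPontryagin.PontryaginBundle I G,
          HamiltonPontryagin.SmoothPontryaginPath I a b c ∧
          (∀ t ∈ Icc a b, (c t).proj = g t) ∧
          HamiltonPontryagin.HPPrinciple I L a b c,
        ∃ c : ℝ → G × GroupLieAlgebra I G × (GroupLieAlgebra I G →L[ℝ] ℝ),
          HamiltonPontryagin.SmoothTrivializedPath I a b c ∧
          (∀ t ∈ Icc a b, (c t).1 = g t) ∧
          HamiltonPontryagin.TrivializedHPPrinciple I
            (HamiltonPontryagin.trivializedLagrangian I L) a b c]) ∧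
    -- the last two principles correspond to each other under left trivialization
    (∀ c : ℝ → HamiltonPontryagin.PontryaginBundle I G,
      HamiltonPontryagin.SmoothPontryaginPath I a b c →
      (HamiltonPontryagin.HPPrinciple I L a b c ↔
        HamiltonPontryagin.TrivializedHPPrinciple I
          (HamiltonPontryagin.trivializedLagrangian I L) a b
          (fun t => HamiltonPontryagin.leftTrivialization I (c t)))) ∧
    -- a solution `(g, v, p)` of the Hamilton-Pontryagin principle has `v = ġ`, `p = ∂L/∂v (g, v)`
    (∀ c : ℝ → HamiltonPontryagin.PontryaginBundle I G,
      HamiltonPontryagin.SmoothPontryaginPath I a b c →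
      HamiltonPontryagin.HPPrinciple I L a b c →
      ∀ t ∈ Icc a b,
        (c t).2.1 = HamiltonPontryagin.velocity I a b (fun s => (c s).proj) t ∧
        ∀ w : TangentSpace I (c t).proj,
          HasDerivAt (fun s : ℝ => L ⟨(c t).proj, (c t).2.1 + s • w⟩) ((c t).2.2 w) 0) := by
  have : CompleteSpace E := FiniteDimensional.complete ℝ E
  refine ⟨fun g hg => ?_, fun c _ =>
    HamiltonPontryagin.hpPrinciple_iff_trivializedHPPrinciple I L c, fun c hc h t ht => ?_⟩
  · tfae_have 1 → 2 := fun h => h.reducedPrinciple I hab hL hg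
    tfae_have 2 → 1 := fun h => h.hamiltonPrinciple I hab
    tfae_have 1 → 4 := fun h => h.exists_trivializedHPPrinciple I hab hL hg
    tfae_have 4 → 1 := fun ⟨_, hc, hcg, h⟩ => h.hamiltonPrinciple I hab hL hc hcg
    tfae_have 3 → 4 := fun ⟨c, hc, hcg, h⟩ =>
      ⟨fun t => HamiltonPontryagin.leftTrivialization I (c t),
        HamiltonPontryagin.contMDiffOn_leftTrivialization I hc, hcg,
        (HamiltonPontryagin.hpPrinciple_iff_trivializedHPPrinciple I L c).1 h⟩
    tfae_have 4 → 3 := fun ⟨c, hc, hcg, h⟩ =>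
      ⟨fun t => HamiltonPontryagin.leftTrivializationSymm I (c t),
        HamiltonPontryagin.contMDiffOn_leftTrivializationSymm I hc.1 hc.2.1 hc.2.2, hcg, by
        rw [HamiltonPontryagin.hpPrinciple_iff_trivializedHPPrinciple]
        simpa only [HamiltonPontryagin.leftTrivialization_symm] using h⟩
    tfae_finish
  · have hl := HamiltonPontryagin.contMDiff_trivializedLagrangian I hL
    obtain ⟨hs1, hs2, hs3⟩ := HamiltonPontryagin.contMDiffOn_leftTrivialization I hc
    obtain ⟨h1, h2⟩ :=
      HamiltonPontryagin.TrivializedHPPrinciple.eq_reducedVelocity_and_eq_deriv (E := E) I hab hl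
        hs1 hs2 hs3 ((HamiltonPontryagin.hpPrinciple_iff_trivializedHPPrinciple I L c).1 h)
    refine ⟨?_, fun w => ?_⟩
    -- Left translation by `g` turns `g⁻¹ v = g⁻¹ ġ` into `v = ġ`.
    · have h3 := congrArg (HamiltonPontryagin.leftTranslate (E := E) I (c t).proj) (h1 t ht)
      exact (HamiltonPontryagin.leftTranslate_leftTranslateInv I (c t).proj
        ((c t).2.1 : E)).symm.trans (h3.trans (HamiltonPontryagin.leftTranslate_leftTranslateInv I (c t).proj
          (HamiltonPontryagin.velocity I a b (fun s => (c s).proj) t : E)))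
    · have h3 := HamiltonPontryagin.hasDerivAt_fiber I hL (c t).proj ((c t).2.1 : E) w
      have h4 := h2 t ht (HamiltonPontryagin.leftTranslateInv I (c t).proj w)
      have h5 := congrArg ((c t).2.2 : E →L[ℝ] ℝ)
        (HamiltonPontryagin.leftTranslate_leftTranslateInv I (c t).proj (w : E))
      exact Eq.mp (congrArg (fun r => HasDerivAt _ r 0) (h4.trans h5)) h3
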